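/- **Setting.** Let $K$ be a subfield of $\mathbb C$ (for instance a number field, or $\mathbb C$ itself), let $F,G\in K(x,y)$ and consider $y'=F(x,y)$. Put $D_x=\partial_x+F\partial_y$. A rational first integral is a nonconstant $f\in\mathbb C(x,y)$ with $D_xf=0$. Let $k\ge 1$. A $k$-Darbouxian first integral is a nonconstant function $\mathcal F$, analytic on an open set of $\mathbb C^2$, with $D_x\mathcal F=0$ and $(\partial_y\mathcal F)^k=R$ for some $R\in K(x,y)$; its integrating factor is $U=\partial_y\mathcal F$, and $D_h=U^{-1}\partial_y$. Let $y(x,h)$ be a general solution (analytic, $\partial_xy=F(x,y)$, $\partial_hy\not\equiv0$) parametrized so that $\mathcal F(x,y(x,h))=h$, and let $I(x,h)=\int G(x,y(x,h))\,dx$ be an analytic antiderivative in $x$. A *$k$-pseudo telescoper* of order $l\ge 0$ is a relation $$\sum_{i=0}^{\lfloor l/k\rfloor}Q_i(x,y(x,h))\,\partial_h^{ki+(l\bmod k)}I(x,h)=U^{-(l\bmod k)}P(x,y(x,h)),\qquad Q_i,P\in K[x,y];$$ it is nontrivial if $Q_0,\dots,Q_{\lfloor l/k\rfloor},P$ are not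 all $0$. A *(true) telescoper* is a relation $$\sum_{i=0}^{s}a_i\,\partial_h^{ki+j}I(x,h)=U^{-j}H(x,y(x,h)),\qquad a_i\in K,\ a_s=1,\ 0\le j<k,\ H\in K(x,y).$$ **Algorithm ReduceTelescoper.** Input: $F,G,k,R=U^k\neq0,l$, and polynomials $Q_i,P$. Let $\tilde l=\lfloor l/k\rfloor$, $e=l\bmod k$ and $L_1=[Q_{\tilde l},\dots,Q_0,P]$. While $L_1,\dots,L_i$ are linearly independent over $K(x,y)$, derive from $L_i=[q_{\tilde l},\dots,q_0,p]$ the row $$L_{i+1}=\Big[D_xq_{\tilde l},\dots,D_xq_0,\ D_xp-e\,p\,U^{-1}D_xU-U^{e}\sum_{j=0}^{\tilde l}q_j\,D_h^{kj+e}G\Big]$$ (its entries are in $K(x,y)$, expressed through $R$), and increase $i$. Then take the last nonzero line $\tilde Q_r,\dots,\tilde Q_0,\tilde P$ of a row echelon form of the matrix of the rows, with $\tilde Q_r$ its first nonzero entry, and return $\sum_{i=0}^r\frac{\tilde Q_i}{\tilde Q_r}\partial_h^{ki+e}I=U^{-e}\frac{\tilde P}{\tilde Q_r}$. The echelon form is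 computed incrementally by Gaussian elimination. **Proposition.** 1. Let $K=\mathbb C$, and suppose that $y'=F(x,y)$ has a $k$-Darbouxian first integral as above and no rational first integral. If a nontrivial $k$-pseudo telescoper for $I$ exists, then a true telescoper for $I$ exists. 2. ReduceTelescoper terminates on every input. 3. Suppose that $y'=F(x,y)$ has a $k$-Darbouxian first integral with $U^k=R\in K(x,y)$ and no rational first integral. If the input is a nontrivial $k$-pseudo telescoper for $I$ over $K$, then ReduceTelescoper returns a true telescoper for $I$, with constant coefficients $a_i\in K$ and $j=l\bmod k$. 4. ReduceTelescoper runs in time $\tilde O(N\,\mathrm{ord}^{\omega+3})$. Precisely: let an arithmetic operation, a partial derivative or a zero test in $K(x,y)$ on reduced fractions of total degree at most $d$ take time $(d+1)\log_2^c(d+2)$ (with the logarithm rounded down), where $c$ is any fixed natural number; this is quasi-linear time in the degree, as for univariate arithmetic with operations of the coefficient field $K(x)$ counted. Then for every feasible exponent $\omega$ of matrix multiplication over $K$ there are constants $A,e$, depending only on $K,\omega,c$, such that on every input whose data $F,G,R=U^k,Q_i,P$ have degree at most $N$ the time is at most $$A\,(N+1)\,(l+1)^{\omega+3}\,\log^e(N+l+3),\qquad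 l=\mathrm{ord}.$$ -/

import Mathlib

open MvPolynomial

/-! ### Rational functions in `x, y` -/

/-- The field `K(x, y)`; the variable of index `0` is `x`, the variable of index `1` is `y`. -/
abbrev RatFun (K : Type*) [Field K] : Type _ := FractionRing (MvPolynomial (Fin 2) K)

namespace RatFun

variable {K : Type*} [Field K]

/-- Numerator of the reduced form. -/
noncomputable def num (f : RatFun K) : MvPolynomial (Fin 2) K :=
  IsFractionRing.num (MvPolynomial (Fin 2) K) f

/-- Denominator of the reduced form. -/
noncomputable def den (f : RatFun K) : MvPolynomial (Fin 2) K :=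
  (IsFractionRing.den (MvPolynomial (Fin 2) K) f : MvPolynomial (Fin 2) K)

/-- A polynomial, seen as a rational function. -/
noncomputable def ofPoly (p : MvPolynomial (Fin 2) K) : RatFun K :=
  algebraMap (MvPolynomial (Fin 2) K) (RatFun K) p

/-- A constant of `K`, seen as a rational function. -/
noncomputable def const (c : K) : RatFun K := ofPoly (C c)

/-- The degree of a rational function: the larger of the total degrees of the numerator and of
the denominator of its reduced form. -/
noncomputable def deg (f : RatFun K) : ℕ := max (num f).totalDegree (den f).totalDegree

/-- The partial derivative with respect to the variable of index `i` (quotient rule). -/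
noncomputable def partialD (i : Fin 2) (f : RatFun K) : RatFun K :=
  ofPoly (pderiv i (num f) * den f - num f * pderiv i (den f)) / ofPoly (den f ^ 2)

/-- The derivation `D_x = ∂_x + F ∂_y`. -/
noncomputable def totalDx (F f : RatFun K) : RatFun K := partialD 0 f + F * partialD 1 f

variable [Algebra K ℂ]

/-- The value of a polynomial at a point of `ℂ²`. -/
noncomputable def polyEval (q : MvPolynomial (Fin 2) K) (z : ℂ × ℂ) : ℂ := aeval ![z.1, z.2] q

/-- The rational function `f` has a value at `z` (its reduced denominator does not vanish). -/
def RegularAt (f : RatFun K) (z : ℂ × ℂ) : Prop := polyEval (den f) z ≠ 0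

/-- The value of a rational function at a point where it is regular. -/
noncomputable def evalAt (f : RatFun K) (z : ℂ × ℂ) : ℂ := polyEval (num f) z / polyEval (den f) z

end RatFun

/-! ### First integrals, general solutions, telescopers -/

section Analytic

variable {K : Type*} [Field K] [Algebra K ℂ]

/-- Complex partial derivative with respect to the first variable. -/
noncomputable def dFst (f : ℂ × ℂ → ℂ) (z : ℂ × ℂ) : ℂ := deriv (fun t => f (t, z.2)) z.1

/-- Complex partial derivative of order `m` with respect to the second variable. -/
noncomputable def dSndIter (m : ℕ) (f : ℂ × ℂ → ℂ) (z : ℂ × ℂ) : ℂ :=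
  iteratedDeriv m (fun t => f (z.1, t)) z.2

/-- Complex partial derivative with respect to the second variable. -/
noncomputable def dSnd (f : ℂ × ℂ → ℂ) (z : ℂ × ℂ) : ℂ := deriv (fun t => f (z.1, t)) z.2

/-- The equation `y' = F(x, y)` has no rational first integral: an element `f` of `ℂ(x, y)` with
`∂_x f + F ∂_y f = 0` (written with the denominator of `F` cleared) is a constant. -/
def NoRationalFirstIntegral (F : RatFun K) : Prop :=
  ∀ f : RatFun ℂ,
    RatFun.ofPoly (MvPolynomial.map (algebraMap K ℂ) F.den) * RatFun.partialD 0 f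
      + RatFun.ofPoly (MvPolynomial.map (algebraMap K ℂ) F.num) * RatFun.partialD 1 f = 0 →
    ∃ c : ℂ, f = RatFun.const c

/-- `Φ`, analytic on the open set `Ω ⊆ ℂ²`, is a `k`-Darbouxian first integral of `y' = F(x, y)`:
`∂_x Φ + F ∂_y Φ = 0` and `(∂_y Φ) ^ k = R`, where `R` is a rational function. It is nonconstant,
that is, `R ≠ 0`. The integrating factor is `U = ∂_y Φ`, a branch of the `k`-th root of `R`. -/
structure IsDarbouxianFirstIntegral (F R : RatFun K) (k : ℕ) (Ω : Set (ℂ × ℂ)) (Φ : ℂ × ℂ → ℂ) :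
    Prop where
  k_pos : 1 ≤ k
  isOpen : IsOpen Ω
  analytic : AnalyticOnNhd ℂ Φ Ω
  nonconstant : R ≠ 0
  first_integral : ∀ z ∈ Ω, F.RegularAt z ∧ dFst Φ z + F.evalAt z * dSnd Φ z = 0
  power : ∀ z ∈ Ω, R.RegularAt z ∧ dSnd Φ z ^ k = R.evalAt z

/-- `y(x, h)`, analytic on the nonempty open set `D`, is a general solution of `y' = F(x, y)`. -/
structure IsGeneralSolution (F : RatFun K) (D : Set (ℂ × ℂ)) (y : ℂ × ℂ → ℂ) : Prop where
  isOpen : IsOpen D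
  nonempty : D.Nonempty
  analytic : AnalyticOnNhd ℂ y D
  solves : ∀ w ∈ D, F.RegularAt (w.1, y w) ∧ dFst y w = F.evalAt (w.1, y w)
  depends : ∃ w ∈ D, dSnd y w ≠ 0

/-- The data of the integration problem: a `k`-Darbouxian first integral `Φ` of `y' = F(x, y)`, a
general solution `y(x, h)` parametrized by the value `h` of `Φ`, and `I(x, h) = ∫ G(x, y(x, h)) dx`
(any analytic antiderivative). -/
structure IsDarbouxianIntegral (F G R : RatFun K) (k : ℕ) (Ω : Set (ℂ × ℂ)) (Φ : ℂ × ℂ → ℂ)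
    (D : Set (ℂ × ℂ)) (y I : ℂ × ℂ → ℂ) : Prop where
  darbouxian : IsDarbouxianFirstIntegral F R k Ω Φ
  solution : IsGeneralSolution F D y
  mem : ∀ w ∈ D, (w.1, y w) ∈ Ω
  level : ∀ w ∈ D, Φ (w.1, y w) = w.2
  analytic : AnalyticOnNhd ℂ I D
  integral : ∀ w ∈ D, G.RegularAt (w.1, y w) ∧ dFst I w = G.evalAt (w.1, y w)

/-- The `k`-pseudo telescoper
`∑_{i ≤ ⌊l/k⌋} Q_i(x, y) ∂_h^{ki + (l mod k)} I = U^{-(l mod k)} P(x, y)`, `y = y(x, h)`,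
with polynomial coefficients and `U = ∂_y Φ`. -/
def IsPseudoTelescoper (k l : ℕ) (Φ : ℂ × ℂ → ℂ) (D : Set (ℂ × ℂ)) (y I : ℂ × ℂ → ℂ)
    (Q : ℕ → MvPolynomial (Fin 2) K) (P : MvPolynomial (Fin 2) K) : Prop :=
  ∀ w ∈ D,
    ∑ i ∈ Finset.range (l / k + 1),
        RatFun.polyEval (Q i) (w.1, y w) * dSndIter (k * i + l % k) I w
      = (dSnd Φ (w.1, y w) ^ (l % k))⁻¹ * RatFun.polyEval P (w.1, y w)

/-- The polynomials that occur in a `k`-pseudo telescoper are not all zero. -/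
def PseudoNontrivial (k l : ℕ) (Q : ℕ → MvPolynomial (Fin 2) K) (P : MvPolynomial (Fin 2) K) :
    Prop :=
  (∃ i ≤ l / k, Q i ≠ 0) ∨ P ≠ 0

/-- The (true) telescoper `∑_{i ≤ s} a_i ∂_h^{ki + j} I = U^{-j} H(x, y)`, `y = y(x, h)`, with
constant coefficients `a_i`, normalized by `a_s = 1`, `0 ≤ j < k`, and with a rational
certificate `H`. The equation is meant wherever `H` has a value. -/
def IsTelescoper (k s j : ℕ) (Φ : ℂ × ℂ → ℂ) (D : Set (ℂ × ℂ)) (y I : ℂ × ℂ → ℂ)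
    (a : ℕ → K) (H : RatFun K) : Prop :=
  j < k ∧ a s = 1 ∧
  ∀ w ∈ D, H.RegularAt (w.1, y w) →
    ∑ i ∈ Finset.range (s + 1), algebraMap K ℂ (a i) * dSndIter (k * i + j) I w
      = (dSnd Φ (w.1, y w) ^ j)⁻¹ * H.evalAt (w.1, y w)

end Analytic

/-! ### Computations with counted operations -/

/-- A computed value together with the list of the operations that were performed: every
operation is recorded by the largest degree of its operands. -/
structure Counted (α : Type*) where
  val : α
  ops : List ℕ

instance : Monad Counted where
  pure a := ⟨a, []⟩
  bind m f := ⟨(f m.val).val, m.ops ++ (f m.val).ops⟩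

/-- The running time when one operation on operands of degree at most `d` takes time
`(d + 1) (log₂ (d + 2)) ^ c`, that is, quasi-linear time in the degree. -/
def runTime (c : ℕ) (ops : List ℕ) : ℕ :=
  (ops.map fun d => (d + 1) * Nat.log 2 (d + 2) ^ c).sum

/-! The elementary operations in `K(x, y)`: the four arithmetic operations, the two partial
derivatives and the zero test. -/

namespace ElementaryOp

variable {K : Type*} [Field K]

noncomputable def add (a b : RatFun K) : Counted (RatFun K) := ⟨a + b, [max a.deg b.deg]⟩

noncomputable def sub (a b : RatFun K) : Counted (RatFun K) := ⟨a - b, [max a.deg b.deg]⟩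

noncomputable def mul (a b : RatFun K) : Counted (RatFun K) := ⟨a * b, [max a.deg b.deg]⟩

noncomputable def div (a b : RatFun K) : Counted (RatFun K) := ⟨a / b, [max a.deg b.deg]⟩

noncomputable def diff (i : Fin 2) (a : RatFun K) : Counted (RatFun K) := ⟨a.partialD i, [a.deg]⟩

open Classical in
noncomputable def isZero (a : RatFun K) : Counted Bool := ⟨decide (a = 0), [a.deg]⟩

end ElementaryOp

/-! ### The algorithm ReduceTelescoper -/

/-- Input of the algorithm: the equation `y' = F(x, y)` with its integrating factor `U`, given by
`U ^ k = R`, the integrand `G`, and a (candidate) `k`-pseudo telescoper of order `l` with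
coefficients `Q_0, …, Q_{⌊l/k⌋}, P`. -/
structure ReduceInput (K : Type*) [Field K] where
  F : RatFun K
  G : RatFun K
  R : RatFun K
  k : ℕ
  l : ℕ
  Q : ℕ → MvPolynomial (Fin 2) K
  P : MvPolynomial (Fin 2) K

/-- A relation `∑_i Q̃_i ∂_h^{ki + (l mod k)} I = U^{-(l mod k)} P̃`, stored as the list
`[Q̃_r, …, Q̃_0]` (decreasing order) and the right-hand side `P̃`. -/
structure RelRow (K : Type*) [Field K] where
  coeffs : List (RatFun K)
  rhs : RatFun K

namespace ReduceTelescoper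

open ElementaryOp

variable {K : Type*} [Field K]

/-- Apply a counted function to all entries of a list. -/
def mapAll {α β : Type*} (f : α → Counted β) : List α → Counted (List β)
  | [] => ⟨[], []⟩
  | a :: as => ⟨(f a).val :: (mapAll f as).val, (f a).ops ++ (mapAll f as).ops⟩

/-- `D_x f = ∂_x f + F ∂_y f`. -/
noncomputable def applyDx (F f : RatFun K) : Counted (RatFun K) := do
  let a ← diff 0 f
  let b ← diff 1 f
  let c ← mul F b
  add a c

/-- The product `∑_j p_j c_j`, added to `acc`. -/
noncomputable def dot : List (RatFun K) → List (RatFun K) → RatFun K → Counted (RatFun K)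
  | p :: ps, c :: cs, acc => do
    let t ← mul p c
    let acc' ← add acc t
    dot ps cs acc'
  | _, _, acc => pure acc

/-- One step of `D_h = U⁻¹ ∂_y` on functions of the form `U^{-m} g` with rational `g`:
`D_h (U^{-m} g) = U^{-(m+1)} (∂_y g - m v g)`, where `v = U⁻¹ ∂_y U = ∂_y R / (k R)`. -/
noncomputable def stepDh (v : RatFun K) (m : ℕ) (g : RatFun K) : Counted (RatFun K) := do
  let a ← diff 1 g
  let b ← mul (m : RatFun K) v
  let c ← mul b g
  sub a c

/-- Starting from `g = g_m`, the list `[g_m, …, g_{m+n}]` with `D_h^i G = U^{-i} g_i`. -/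
noncomputable def powersDh (v : RatFun K) : ℕ → ℕ → RatFun K → Counted (List (RatFun K))
  | 0, _, g => pure [g]
  | n + 1, m, g => do
    let g' ← stepDh v m g
    let rest ← powersDh v n (m + 1) g'
    pure (g :: rest)

/-- Starting from `w = R^{-j}`, the list of the rational functions
`U^{l mod k} D_h^{ki + (l mod k)} G = R^{-i} g_{ki + (l mod k)}` for `j ≤ i < j + n`; here `e` is
`l mod k` and `gs` is the list `[g_0, …, g_l]`. -/
noncomputable def integrandTerms (R : RatFun K) (k e : ℕ) (gs : List (RatFun K)) :
    ℕ → ℕ → RatFun K → Counted (List (RatFun K))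
  | 0, _, _ => pure []
  | n + 1, j, w => do
    let t ← mul w (gs.getD (k * j + e) 0)
    let w' ← div w R
    let rest ← integrandTerms R k e gs n (j + 1) w'
    pure (t :: rest)

/-- The auxiliary quantities: `u = U⁻¹ D_x U = D_x R / (k R)`, and the list of the
`U^{l mod k} D_h^{ki + (l mod k)} G` for `i = ⌊l/k⌋, …, 0` (decreasing order). -/
noncomputable def prepare (inp : ReduceInput K) : Counted (RatFun K × List (RatFun K)) := do
  let kR ← mul (inp.k : RatFun K) inp.R
  let Ry ← diff 1 inp.R
  let v ← div Ry kR
  let DR ← applyDx inp.F inp.R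
  let u ← div DR kR
  let gs ← powersDh v inp.l 0 inp.G
  let ts ← integrandTerms inp.R inp.k (inp.l % inp.k) gs (inp.l / inp.k + 1) 0 1
  pure (u, ts.reverse)

/-- The first row `L_1 = [Q_{⌊l/k⌋}, …, Q_0, P]`. -/
noncomputable def firstRow (inp : ReduceInput K) : RelRow K where
  coeffs := ((List.range (inp.l / inp.k + 1)).map fun i => RatFun.ofPoly (inp.Q i)).reverse
  rhs := RatFun.ofPoly inp.P

/-- The row `L_{i+1}` computed from `L_i`: the coefficients are differentiated by `D_x`, and the
right-hand side `p` becomes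
`D_x p - (l mod k) p U⁻¹ D_x U - U^{l mod k} ∑_j q_j D_h^{kj + (l mod k)} G`. -/
noncomputable def nextRow (inp : ReduceInput K) (u : RatFun K) (ts : List (RatFun K))
    (L : RelRow K) : Counted (RelRow K) := do
  let q ← mapAll (applyDx inp.F) L.coeffs
  let a ← applyDx inp.F L.rhs
  let b ← mul ((inp.l % inp.k : ℕ) : RatFun K) L.rhs
  let b' ← mul b u
  let c ← dot L.coeffs ts 0
  let d ← sub a b'
  let p ← sub d c
  pure ⟨q, p⟩

/-- `row - f • b`. -/
noncomputable def subMul (f : RatFun K) : List (RatFun K) → List (RatFun K) →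
    Counted (List (RatFun K))
  | a :: as, b :: bs => do
    let t ← mul f b
    let a' ← sub a t
    let rest ← subMul f as bs
    pure (a' :: rest)
  | _, _ => pure []

/-- Gaussian elimination of a new row by the rows found so far; each of these is stored with the
column of its first nonzero entry (its pivot). -/
noncomputable def eliminate : List (ℕ × List (RatFun K)) → List (RatFun K) →
    Counted (List (RatFun K))
  | [], row => pure row
  | (p, b) :: rest, row => do
    let f ← div (row.getD p 0) (b.getD p 0)
    let row' ← subMul f row b
    eliminate rest row'

/-- The column of the first nonzero entry, if there is one (columns are numbered from `j`). -/
noncomputable def pivot : ℕ → List (RatFun K) → Counted (Option ℕ)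
  | _, [] => pure none
  | j, a :: as => do
    let z ← isZero a
    if z then pivot (j + 1) as else pure (some j)

/-- State of the loop: the current row `L_i`, and an echelon basis of the span of
`L_1, …, L_{i-1}` over `K(x, y)`: its rows have pairwise distinct pivots. -/
structure LoopState (K : Type*) [Field K] where
  current : RelRow K
  basis : List (ℕ × List (RatFun K))

/-- One pass of the loop. If `L_i` depends linearly on `L_1, …, L_{i-1}`, the loop is left with
the echelon form; otherwise the reduced row is added to it and `L_{i+1}` is computed. -/
noncomputable def loopStep (inp : ReduceInput K) (u : RatFun K) (ts : List (RatFun K))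
    (st : LoopState K) : Counted (List (ℕ × List (RatFun K)) ⊕ LoopState K) :=
  let row := eliminate st.basis (st.current.coeffs ++ [st.current.rhs])
  let pv := pivot 0 row.val
  match pv.val with
  | none => ⟨Sum.inl st.basis, row.ops ++ pv.ops⟩
  | some p =>
    let L := nextRow inp u ts st.current
    ⟨Sum.inr ⟨L.val, st.basis ++ [(p, row.val)]⟩, row.ops ++ pv.ops ++ L.ops⟩

/-- Execution of the while loop: from the state `st` the loop stops after finitely many passes
with the echelon form `B`, and `ops` lists the operations that were performed. -/
inductive LoopRuns (inp : ReduceInput K) (u : RatFun K) (ts : List (RatFun K)) :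
    LoopState K → List (ℕ × List (RatFun K)) → List ℕ → Prop
  | halt (st : LoopState K) (B : List (ℕ × List (RatFun K)))
      (h : (loopStep inp u ts st).val = Sum.inl B) :
      LoopRuns inp u ts st B (loopStep inp u ts st).ops
  | next (st st' : LoopState K) (B : List (ℕ × List (RatFun K))) (ops : List ℕ)
      (h : (loopStep inp u ts st).val = Sum.inr st') (h' : LoopRuns inp u ts st' B ops) :
      LoopRuns inp u ts st B ((loopStep inp u ts st).ops ++ ops)

/-- The last nonzero line of the echelon form (the one with the largest pivot), divided by its
first nonzero coefficient. There is no output (`none`) if that line does not exist or has no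
nonzero coefficient on the left-hand side. -/
noncomputable def normalizeLast (inp : ReduceInput K) (B : List (ℕ × List (RatFun K))) :
    Counted (Option (RelRow K)) :=
  match B.argmax Prod.fst with
  | none => pure none
  | some (p, b) =>
    if p ≤ inp.l / inp.k then do
      let w ← mapAll (fun a => div a (b.getD p 0)) (b.drop p)
      pure (some ⟨w.dropLast, w.getLastD 0⟩)
    else pure none

/-- The algorithm ReduceTelescoper, run on `inp`, halts with output `out` after the operations
`ops`. -/
def Runs (inp : ReduceInput K) (out : Option (RelRow K)) (ops : List ℕ) : Prop :=
  ∃ B loopOps,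
    LoopRuns inp (prepare inp).val.1 (prepare inp).val.2 ⟨firstRow inp, []⟩ B loopOps ∧
    out = (normalizeLast inp B).val ∧
    ops = (prepare inp).ops ++ loopOps ++ (normalizeLast inp B).ops

end ReduceTelescoper

/-- All rational functions and polynomials of the input have degree at most `N`. -/
def ReduceInput.DegreeLE {K : Type*} [Field K] (inp : ReduceInput K) (N : ℕ) : Prop :=
  inp.F.deg ≤ N ∧ inp.G.deg ≤ N ∧ inp.R.deg ≤ N ∧
    (∀ i ≤ inp.l / inp.k, (inp.Q i).totalDegree ≤ N) ∧ inp.P.totalDegree ≤ N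

/-- `ω` is a feasible exponent of matrix multiplication over `K`: there is a constant `A` such
that two `n × n` matrices can be multiplied by a bilinear algorithm with at most `A n ^ ω`
multiplications, for every `n ≥ 1`. -/
def IsMatMulExponent (K : Type*) [Field K] (ω : ℝ) : Prop :=
  ∃ A : ℝ, ∀ n : ℕ, 1 ≤ n → ∃ r : ℕ, (r : ℝ) ≤ A * (n : ℝ) ^ ω ∧
    ∃ (f g : Fin r → (Matrix (Fin n) (Fin n) K →ₗ[K] K)) (W : Fin r → Matrix (Fin n) (Fin n) K),
      ∀ X Y : Matrix (Fin n) (Fin n) K, X * Y = ∑ t, (f t X * g t Y) • W t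

/-! Write `m = ⌊l/k⌋` and `e = l mod k`. A row `v` of `m + 2` rational functions encodes the
relation `∑ v_c ∂_h^{k(m-c)+e} I = U^{-e} v_{m+1}` along the solution. The rows whose relation holds
generically form a `K(x,y)`-vector space (`relations`). It is stable under differentiation in `x`,
because `∂_x` acts as `D_x` on rational functions of `(x, y(x,h))`, and `∂_x ∂_h^n I = ∂_h^n G` is
`U^{-n}` times a rational function. On rows this differentiation is `rowDeriv`, which is additive
and satisfies the Leibniz rule, and `L_{i+1}` is the image of `L_i` (`rowSeq_succ`). As soon as some
`L_{r+1}` depends on `L_1, …, L_r`, the span of these rows is stable (`rowDeriv_mem_spanLT`).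

Let `v` be the echelon line with the largest pivot `p`, scaled so that `v_p = 1`. That pivot is not
the right-hand column, since otherwise the relation would read `0 = U^{-e}`. The derivative of `v`
lies in the span and vanishes in every pivot column: to the left of `p` the line is zero, at `p` it
is `1`, and no pivot lies further right. A vector of the span that vanishes at all pivots is zero
(`Echelon.eq_zero`). Hence `D_x v_c = 0` for all coefficients, and these are constants of `K`
because there is no rational first integral (`NoRationalFirstIntegral.eq_const`). This is
`Runs.telescoper`. Existence over `ℂ` follows by running the algorithm, and termination holds
because pivots occupy distinct columns among `m + 2`.

For the running time, all row entries are written over powers of one common denominator `S`, whose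
exponents grow linearly in `l` (`HasDenominator.rowSeq`). Cramer's rule makes every intermediate
entry of the elimination a quotient of expressions in minors, so degrees stay `O(N l²)`
(`Echelon.deg_le_of_reduced`). Ordinary elimination uses `O(l³)` operations. The product `N l⁵` is
within `N l^{ω+3}` because a feasible exponent satisfies `ω ≥ 2` (`IsMatMulExponent.two_le`); no
fast multiplication is needed. -/

namespace RatFun

/-! ### Reduced fractions in two variables. -/

section Algebra

variable {K : Type*} [Field K]

lemma ofPoly_inj {p q : MvPolynomial (Fin 2) K} : ofPoly p = ofPoly q ↔ p = q :=
  (IsFractionRing.injective (MvPolynomial (Fin 2) K) (RatFun K)).eq_iff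

lemma ofPoly_add (p q : MvPolynomial (Fin 2) K) : ofPoly (p + q) = ofPoly p + ofPoly q :=
  map_add _ _ _

lemma ofPoly_sub (p q : MvPolynomial (Fin 2) K) : ofPoly (p - q) = ofPoly p - ofPoly q :=
  map_sub _ _ _

lemma ofPoly_mul (p q : MvPolynomial (Fin 2) K) : ofPoly (p * q) = ofPoly p * ofPoly q :=
  map_mul _ _ _

lemma ofPoly_pow (p : MvPolynomial (Fin 2) K) (n : ℕ) : ofPoly (p ^ n) = ofPoly p ^ n :=
  map_pow _ _ _

@[simp] lemma ofPoly_one : ofPoly (1 : MvPolynomial (Fin 2) K) = 1 := map_one _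

@[simp] lemma ofPoly_zero : ofPoly (0 : MvPolynomial (Fin 2) K) = 0 := map_zero _

lemma ofPoly_natCast (n : ℕ) : ofPoly (n : MvPolynomial (Fin 2) K) = n := map_natCast _ _

@[simp] lemma ofPoly_eq_zero {p : MvPolynomial (Fin 2) K} : ofPoly p = 0 ↔ p = 0 := by
  rw [← ofPoly_zero, ofPoly_inj]

lemma den_ne_zero (f : RatFun K) : den f ≠ 0 :=
  nonZeroDivisors.ne_zero (IsFractionRing.den (MvPolynomial (Fin 2) K) f).2

lemma ofPoly_den_ne_zero (f : RatFun K) : ofPoly (den f) ≠ 0 := by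
  simpa using den_ne_zero f

lemma num_div_den (f : RatFun K) : ofPoly (num f) / ofPoly (den f) = f :=
  IsFractionRing.mk'_num_den' _ f

lemma exists_eq_div (f : RatFun K) :
    ∃ p q : MvPolynomial (Fin 2) K, q ≠ 0 ∧ f = ofPoly p / ofPoly q :=
  ⟨num f, den f, den_ne_zero f, (num_div_den f).symm⟩

lemma num_mul_eq {p q : MvPolynomial (Fin 2) K} (hq : q ≠ 0) {f : RatFun K}
    (h : f = ofPoly p / ofPoly q) : num f * q = p * den f := by
  rw [← ofPoly_inj, ofPoly_mul, ofPoly_mul, ← div_eq_div_iff (ofPoly_den_ne_zero f) (by simpa),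
    num_div_den, h]

/-- Every representation of `f` as a fraction is a multiple of the reduced one. -/
lemma exists_common_factor {p q : MvPolynomial (Fin 2) K} (hq : q ≠ 0) {f : RatFun K}
    (h : f = ofPoly p / ofPoly q) : ∃ c, c ≠ 0 ∧ p = num f * c ∧ q = den f * c := by
  have h1 := num_mul_eq hq h
  have hrel : IsRelPrime (num f) (den f) :=
    IsFractionRing.num_den_reduced (MvPolynomial (Fin 2) K) f
  obtain ⟨c, hc⟩ : den f ∣ q :=
    hrel.symm.dvd_of_dvd_mul_left (h1 ▸ Dvd.intro_left p rfl)
  refine ⟨c, fun h0 => hq (by rw [hc, h0, mul_zero]), ?_, hc⟩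
  have : den f * (num f * c) = den f * p := by rw [mul_comm _ p, ← h1, hc]; ring
  exact (mul_left_cancel₀ (den_ne_zero f) this).symm

lemma num_eq_zero {f : RatFun K} : num f = 0 ↔ f = 0 := by
  constructor
  · intro h
    rw [← num_div_den f, h, ofPoly_zero, zero_div]
  · rintro rfl
    have := num_mul_eq (p := 0) (q := 1) (f := (0 : RatFun K)) one_ne_zero (by simp)
    simpa using this

/-! ### Degrees -/

lemma totalDegree_le_mul {p c : MvPolynomial (Fin 2) K} (hc : c ≠ 0) :
    p.totalDegree ≤ (p * c).totalDegree := by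
  rcases eq_or_ne p 0 with rfl | hp
  · simp
  · rw [totalDegree_mul_of_isDomain hp hc]; omega

/-- The reduced form divides every other representation, so degrees may be bounded on any convenient
fraction without computing a gcd. -/
lemma deg_le_of_eq_div {p q : MvPolynomial (Fin 2) K} (hq : q ≠ 0) {f : RatFun K}
    (h : f = ofPoly p / ofPoly q) : deg f ≤ max p.totalDegree q.totalDegree := by
  obtain ⟨c, hc, rfl, rfl⟩ := exists_common_factor hq h
  exact max_le_max (totalDegree_le_mul hc) (totalDegree_le_mul hc)

lemma totalDegree_num_le (f : RatFun K) : (num f).totalDegree ≤ deg f := le_max_left _ _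

lemma totalDegree_den_le (f : RatFun K) : (den f).totalDegree ≤ deg f := le_max_right _ _

lemma deg_mul_le (f g : RatFun K) : deg (f * g) ≤ deg f + deg g := by
  have h : f * g = ofPoly (num f * num g) / ofPoly (den f * den g) := by
    rw [ofPoly_mul, ofPoly_mul, ← div_mul_div_comm, num_div_den, num_div_den]
  refine (deg_le_of_eq_div (mul_ne_zero (den_ne_zero f) (den_ne_zero g)) h).trans ?_
  exact max_le ((totalDegree_mul _ _).trans (add_le_add (totalDegree_num_le f)
    (totalDegree_num_le g))) ((totalDegree_mul _ _).trans (add_le_add (totalDegree_den_le f)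
    (totalDegree_den_le g)))

@[simp] lemma deg_zero : deg (0 : RatFun K) = 0 := by
  have := deg_le_of_eq_div (p := 0) (q := 1) (f := (0 : RatFun K)) one_ne_zero (by simp)
  simpa using this

lemma deg_inv_le (f : RatFun K) : deg f⁻¹ ≤ deg f := by
  rcases eq_or_ne f 0 with rfl | hf
  · simp
  · have h : f⁻¹ = ofPoly (den f) / ofPoly (num f) := by
      rw [← inv_div, num_div_den]
    refine (deg_le_of_eq_div (mt num_eq_zero.1 hf) h).trans ?_
    rw [max_comm]; rfl

lemma deg_div_le (f g : RatFun K) : deg (f / g) ≤ deg f + deg g := by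
  rw [div_eq_mul_inv]
  exact (deg_mul_le _ _).trans (add_le_add_right (deg_inv_le g) _)

lemma totalDegree_pderiv_le (i : Fin 2) (p : MvPolynomial (Fin 2) K) :
    (pderiv i p).totalDegree ≤ p.totalDegree - 1 := by
  refine Finset.sup_le fun m hm => ?_
  have h1 : m + Finsupp.single i 1 ∈ p.support := by
    rw [mem_support_iff, coeff_pderiv] at hm
    exact mem_support_iff.2 (left_ne_zero_of_mul hm)
  have h2 := le_totalDegree h1
  rw [Finsupp.sum_add_index' (fun _ => rfl) (fun _ _ _ => rfl), Finsupp.sum_single_index rfl] at h2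
  omega

/-! ### Partial derivatives -/

/-- A common factor `c` contributes `c²` to both sides of the quotient rule and cancels. This
independence of the representation yields the sum and product rules below. -/
lemma partialD_of_eq_div (i : Fin 2) {p q : MvPolynomial (Fin 2) K} (hq : q ≠ 0) {f : RatFun K}
    (h : f = ofPoly p / ofPoly q) :
    partialD i f = ofPoly (pderiv i p * q - p * pderiv i q) / ofPoly (q ^ 2) := by
  obtain ⟨c, hc, rfl, rfl⟩ := exists_common_factor hq h
  rw [partialD, div_eq_div_iff (by simpa using den_ne_zero f) (by simpa using hq), ← ofPoly_mul,
    ← ofPoly_mul, ofPoly_inj, Derivation.leibniz, Derivation.leibniz]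
  simp only [smul_eq_mul]
  ring

lemma partialD_ofPoly (i : Fin 2) (p : MvPolynomial (Fin 2) K) :
    partialD i (ofPoly p) = ofPoly (pderiv i p) := by
  rw [partialD_of_eq_div i (p := p) (q := 1) one_ne_zero (by simp)]
  simp

lemma partialD_add (i : Fin 2) (f g : RatFun K) :
    partialD i (f + g) = partialD i f + partialD i g := by
  obtain ⟨p, q, hq, hf⟩ := exists_eq_div f
  obtain ⟨r, s, hs, hg⟩ := exists_eq_div g
  have hq' : ofPoly q ≠ 0 := by simpa
  have hs' : ofPoly s ≠ 0 := by simpa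
  have h : f + g = ofPoly (p * s + q * r) / ofPoly (q * s) := by
    rw [hf, hg, div_add_div _ _ hq' hs']; simp only [ofPoly_add, ofPoly_mul]
  rw [partialD_of_eq_div i (mul_ne_zero hq hs) h, partialD_of_eq_div i hq hf,
    partialD_of_eq_div i hs hg]
  simp only [map_add, Derivation.leibniz, smul_eq_mul, ofPoly_add, ofPoly_sub, ofPoly_mul,
    ofPoly_pow]
  field_simp
  ring

lemma partialD_mul (i : Fin 2) (f g : RatFun K) :
    partialD i (f * g) = f * partialD i g + g * partialD i f := by
  obtain ⟨p, q, hq, hf⟩ := exists_eq_div f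
  obtain ⟨r, s, hs, hg⟩ := exists_eq_div g
  have hq' : ofPoly q ≠ 0 := by simpa
  have hs' : ofPoly s ≠ 0 := by simpa
  have h : f * g = ofPoly (p * r) / ofPoly (q * s) := by
    rw [hf, hg, div_mul_div_comm, ofPoly_mul, ofPoly_mul]
  rw [partialD_of_eq_div i (mul_ne_zero hq hs) h, partialD_of_eq_div i hq hf,
    partialD_of_eq_div i hs hg, hf, hg]
  simp only [Derivation.leibniz, smul_eq_mul, ofPoly_add, ofPoly_sub, ofPoly_mul,
    ofPoly_pow]
  field_simp
  ring

@[simp] lemma partialD_one (i : Fin 2) : partialD i (1 : RatFun K) = 0 := by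
  rw [← ofPoly_one, partialD_ofPoly]; simp

@[simp] lemma partialD_zero (i : Fin 2) : partialD i (0 : RatFun K) = 0 := by
  rw [← ofPoly_zero, partialD_ofPoly]; simp

lemma totalDx_add (F f g : RatFun K) : totalDx F (f + g) = totalDx F f + totalDx F g := by
  simp only [totalDx, partialD_add]; ring

lemma totalDx_mul (F f g : RatFun K) :
    totalDx F (f * g) = f * totalDx F g + g * totalDx F f := by
  simp only [totalDx, partialD_mul]; ring

@[simp] lemma totalDx_one (F : RatFun K) : totalDx F (1 : RatFun K) = 0 := by
  simp [totalDx]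

@[simp] lemma totalDx_zero (F : RatFun K) : totalDx F (0 : RatFun K) = 0 := by
  simp [totalDx]

/-! ### Fractions with a power of a fixed denominator -/

/-- `f = p / S ^ M` with a polynomial `p` of degree at most `M * d`. -/
def PowerFraction (S : MvPolynomial (Fin 2) K) (d M : ℕ) (f : RatFun K) : Prop :=
  ∃ p : MvPolynomial (Fin 2) K, p.totalDegree ≤ M * d ∧ f = ofPoly p / ofPoly (S ^ M)

namespace PowerFraction

variable {S : MvPolynomial (Fin 2) K} {d M M' : ℕ} {f g : RatFun K}

lemma deg_le (hS : S ≠ 0) (hd : S.totalDegree ≤ d) (hf : PowerFraction S d M f) :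
    deg f ≤ M * d := by
  obtain ⟨p, hp, h⟩ := hf
  refine (deg_le_of_eq_div (pow_ne_zero _ hS) h).trans (max_le hp ?_)
  exact (totalDegree_pow _ _).trans (Nat.mul_le_mul_left _ hd)

/-- Bringing fractions to a common exponent is what keeps sums cheap: denominators are not
multiplied together. -/
lemma mono (hS : S ≠ 0) (hd : S.totalDegree ≤ d) (hf : PowerFraction S d M f) (h : M ≤ M') :
    PowerFraction S d M' f := by
  obtain ⟨j, rfl⟩ := Nat.exists_eq_add_of_le h
  obtain ⟨p, hp, rfl⟩ := hf
  have hS' : ofPoly S ≠ 0 := by simpa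
  refine ⟨p * S ^ j, ?_, ?_⟩
  · refine (totalDegree_mul _ _).trans ?_
    rw [add_mul]
    exact add_le_add hp ((totalDegree_pow _ _).trans (Nat.mul_le_mul_left _ hd))
  · simp only [ofPoly_mul, ofPoly_pow, pow_add]
    field_simp

lemma add (hf : PowerFraction S d M f) (hg : PowerFraction S d M g) :
    PowerFraction S d M (f + g) := by
  obtain ⟨p, hp, rfl⟩ := hf
  obtain ⟨q, hq, rfl⟩ := hg
  exact ⟨p + q, (totalDegree_add _ _).trans (max_le hp hq), by rw [ofPoly_add, add_div]⟩

lemma sub (hf : PowerFraction S d M f) (hg : PowerFraction S d M g) :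
    PowerFraction S d M (f - g) := by
  obtain ⟨p, hp, rfl⟩ := hf
  obtain ⟨q, hq, rfl⟩ := hg
  exact ⟨p - q, (totalDegree_sub _ _).trans (max_le hp hq), by rw [ofPoly_sub, sub_div]⟩

lemma mul (hf : PowerFraction S d M f) (hg : PowerFraction S d M' g) :
    PowerFraction S d (M + M') (f * g) := by
  obtain ⟨p, hp, rfl⟩ := hf
  obtain ⟨q, hq, rfl⟩ := hg
  refine ⟨p * q, (totalDegree_mul _ _).trans ?_, ?_⟩
  · rw [add_mul]; exact add_le_add hp hq
  · rw [pow_add, ofPoly_mul, ofPoly_mul, div_mul_div_comm]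

lemma zero : PowerFraction S d M 0 := ⟨0, by simp, by simp⟩

lemma const (c : K) : PowerFraction S d 0 (const c) := ⟨C c, by simp, by simp [RatFun.const]⟩

lemma natCast (n : ℕ) : PowerFraction S d 0 (n : RatFun K) := by
  have : (n : RatFun K) = RatFun.const (n : K) := by
    rw [RatFun.const, map_natCast, ofPoly_natCast]
  exact this ▸ const _

lemma one : PowerFraction S d 0 (1 : RatFun K) := by simpa using natCast (S := S) (d := d) 1

lemma natCast_inv (n : ℕ) : PowerFraction S d 0 (n : RatFun K)⁻¹ := by
  have : (n : RatFun K)⁻¹ = RatFun.const (n : K)⁻¹ := by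
    -- If `n` vanishes in `K`, both inverses are `0` by convention.
    rcases eq_or_ne (n : K) 0 with h | h
    · rw [← ofPoly_natCast, ← map_natCast (C : K →+* MvPolynomial (Fin 2) K), h]
      simp [RatFun.const]
    · refine inv_eq_of_mul_eq_one_right ?_
      rw [RatFun.const, ← ofPoly_natCast, ← map_natCast (C : K →+* MvPolynomial (Fin 2) K),
        ← ofPoly_mul, ← map_mul, mul_inv_cancel₀ h]
      simp
  exact this ▸ const _

lemma ofPoly {p : MvPolynomial (Fin 2) K} (hS : S ≠ 0) (h : S.totalDegree + p.totalDegree ≤ d) :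
    PowerFraction S d 1 (ofPoly p) := by
  have hS' : RatFun.ofPoly S ≠ 0 := by simpa
  refine ⟨p * S, (totalDegree_mul _ _).trans (by omega), ?_⟩
  rw [pow_one, ofPoly_mul, mul_div_cancel_right₀ _ hS']

/-- A fraction whose denominator divides `S`. -/
lemma of_dvd {p q r : MvPolynomial (Fin 2) K} (hS : S ≠ 0)
    (hf : f = RatFun.ofPoly p / RatFun.ofPoly q) (h : S = q * r)
    (hd : p.totalDegree + r.totalDegree ≤ d) : PowerFraction S d 1 f := by
  subst h
  have hr : RatFun.ofPoly r ≠ 0 := by simpa using right_ne_zero_of_mul hS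
  refine ⟨p * r, (totalDegree_mul _ _).trans (by omega), ?_⟩
  rw [hf, pow_one, ofPoly_mul, ofPoly_mul, mul_div_mul_right _ _ hr]

/-- `∂(p / S^M) = (S ∂p - M p ∂S) / S^(M+1)`: the exponent rises by one only, whereas the plain
quotient rule would double it. -/
lemma partialD (hS : S ≠ 0) (hd : S.totalDegree ≤ d) (i : Fin 2) (hf : PowerFraction S d M f) :
    PowerFraction S d (M + 1) (partialD i f) := by
  obtain ⟨p, hp, hf⟩ := hf
  -- The Leibniz rule for `S^M` involves the truncated exponent `M - 1`, so `M = 0` is treated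
  -- apart; there the degree bound forces a constant numerator.
  rcases Nat.eq_zero_or_pos M with rfl | hM
  · have hf' : f = RatFun.ofPoly p := by simpa using hf
    have hp0 : p = C (coeff 0 p) := totalDegree_eq_zero_iff_eq_C.1 (by simpa using hp)
    rw [hf', hp0, partialD_ofPoly]
    simpa using zero
  have hS' : RatFun.ofPoly S ≠ 0 := by simpa
  refine ⟨pderiv i p * S - M * (p * pderiv i S), ?_, ?_⟩
  · refine (totalDegree_sub _ _).trans (max_le ?_ ?_)
    · refine (totalDegree_mul _ _).trans ?_
      have := totalDegree_pderiv_le i p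
      rw [add_mul]; omega
    · refine (totalDegree_mul _ _).trans ?_
      have h0 : (M : MvPolynomial (Fin 2) K).totalDegree = 0 := by
        rw [← map_natCast (C : K →+* MvPolynomial (Fin 2) K), totalDegree_C]
      have := totalDegree_pderiv_le i S
      have := totalDegree_mul p (pderiv i S)
      rw [add_mul]; omega
  · rw [partialD_of_eq_div i (pow_ne_zero M hS) hf,
      div_eq_div_iff (by simpa using fun h => (hS h).elim)
      (by simpa using fun h => (hS h).elim), ← ofPoly_mul, ← ofPoly_mul, ofPoly_inj,
      Derivation.leibniz_pow]
    obtain ⟨m, rfl⟩ := Nat.exists_eq_add_of_le' hM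
    simp only [smul_eq_mul, nsmul_eq_mul, Nat.add_sub_cancel]
    ring

lemma sum {ι : Type*} {s : Finset ι} {f : ι → RatFun K}
    (h : ∀ i ∈ s, PowerFraction S d M (f i)) : PowerFraction S d M (∑ i ∈ s, f i) :=
  Finset.sum_induction _ _ (fun _ _ => add) zero h

lemma prod {ι : Type*} {s : Finset ι} {f : ι → RatFun K}
    (h : ∀ i ∈ s, PowerFraction S d M (f i)) : PowerFraction S d (s.card * M) (∏ i ∈ s, f i) := by
  classical
  induction s using Finset.induction_on with
  | empty => simpa using one
  | insert a s ha ih =>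
    rw [Finset.prod_insert ha, Finset.card_insert_of_notMem ha, add_mul, one_mul, add_comm]
    exact (h a (Finset.mem_insert_self _ _)).mul
      (ih fun i hi => h i (Finset.mem_insert_of_mem hi))

lemma neg (hf : PowerFraction S d M f) : PowerFraction S d M (-f) := by
  simpa using zero.sub hf

/-- Each term of the Leibniz expansion is a product of `n` entries, and all terms share the
denominator `S^(nM)`. -/
lemma det {n : ℕ} {A : Matrix (Fin n) (Fin n) (RatFun K)}
    (h : ∀ i j, PowerFraction S d M (A i j)) : PowerFraction S d (n * M) A.det := by
  rw [Matrix.det_apply]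
  refine sum fun σ _ => ?_
  have h1 := prod (s := Finset.univ) (f := fun i => A (σ i) i) fun i _ => h (σ i) i
  rw [Finset.card_univ, Fintype.card_fin] at h1
  rcases Int.units_eq_one_or (Equiv.Perm.sign σ) with hs | hs <;> rw [hs]
  · simpa using h1
  · simpa using h1.neg

end PowerFraction

end Algebra

end RatFun

namespace RatFun

/-! ### Values and derivatives of rational functions at points of `ℂ²`. -/

section Evaluation

variable {K : Type*} [Field K] [Algebra K ℂ]

lemma polyEval_add (p q : MvPolynomial (Fin 2) K) (z : ℂ × ℂ) :
    polyEval (p + q) z = polyEval p z + polyEval q z := map_add _ _ _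

lemma polyEval_sub (p q : MvPolynomial (Fin 2) K) (z : ℂ × ℂ) :
    polyEval (p - q) z = polyEval p z - polyEval q z := map_sub _ _ _

lemma polyEval_mul (p q : MvPolynomial (Fin 2) K) (z : ℂ × ℂ) :
    polyEval (p * q) z = polyEval p z * polyEval q z := map_mul _ _ _

lemma polyEval_pow (p : MvPolynomial (Fin 2) K) (n : ℕ) (z : ℂ × ℂ) :
    polyEval (p ^ n) z = polyEval p z ^ n := map_pow _ _ _

@[simp] lemma polyEval_C (c : K) (z : ℂ × ℂ) : polyEval (C c) z = algebraMap K ℂ c :=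
  aeval_C _ _

@[simp] lemma polyEval_one (z : ℂ × ℂ) : polyEval (1 : MvPolynomial (Fin 2) K) z = 1 := map_one _

@[simp] lemma polyEval_zero (z : ℂ × ℂ) : polyEval (0 : MvPolynomial (Fin 2) K) z = 0 :=
  map_zero _

/-- The rational function `f` is regular at `z`, with value `v`. -/
def HasValue (f : RatFun K) (z : ℂ × ℂ) (v : ℂ) : Prop := RegularAt f z ∧ evalAt f z = v

lemma RegularAt.hasValue {f : RatFun K} {z : ℂ × ℂ} (h : RegularAt f z) :
    HasValue f z (evalAt f z) := ⟨h, rfl⟩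

/-- The reduced denominator divides `q`, so it cannot vanish where `q` does not; the common factor
cancels in the value. -/
lemma hasValue_of_eq_div {f : RatFun K} {p q : MvPolynomial (Fin 2) K} {z : ℂ × ℂ}
    (h : f = ofPoly p / ofPoly q) (hz : polyEval q z ≠ 0) :
    HasValue f z (polyEval p z / polyEval q z) := by
  have hq : q ≠ 0 := by rintro rfl; simp at hz
  obtain ⟨c, -, rfl, rfl⟩ := exists_common_factor hq h
  rw [polyEval_mul] at hz
  refine ⟨left_ne_zero_of_mul hz, ?_⟩
  rw [polyEval_mul, polyEval_mul, mul_div_mul_right _ _ (right_ne_zero_of_mul hz)]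
  rfl

lemma hasValue_iff {f : RatFun K} {z : ℂ × ℂ} {v : ℂ} :
    HasValue f z v ↔ ∃ p q : MvPolynomial (Fin 2) K, f = ofPoly p / ofPoly q ∧ q ≠ 0 ∧
      polyEval q z ≠ 0 ∧ v = polyEval p z / polyEval q z := by
  constructor
  · rintro ⟨h, rfl⟩
    exact ⟨num f, den f, (num_div_den f).symm, den_ne_zero f, h, rfl⟩
  · rintro ⟨p, q, h, -, hz, rfl⟩
    exact hasValue_of_eq_div h hz

lemma hasValue_ofPoly (p : MvPolynomial (Fin 2) K) (z : ℂ × ℂ) :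
    HasValue (ofPoly p) z (polyEval p z) := by
  simpa using hasValue_of_eq_div (f := ofPoly p) (p := p) (q := 1) (z := z) (by simp) (by simp)

lemma hasValue_const (c : K) (z : ℂ × ℂ) : HasValue (const c) z (algebraMap K ℂ c) := by
  have h := hasValue_ofPoly (C c) z
  rwa [polyEval_C] at h

lemma hasValue_natCast (n : ℕ) (z : ℂ × ℂ) : HasValue (n : RatFun K) z n := by
  have := hasValue_ofPoly (n : MvPolynomial (Fin 2) K) z
  rwa [ofPoly_natCast, polyEval, map_natCast] at this

lemma hasValue_zero (z : ℂ × ℂ) : HasValue (0 : RatFun K) z 0 := by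
  simpa using hasValue_ofPoly (0 : MvPolynomial (Fin 2) K) z

lemma hasValue_one (z : ℂ × ℂ) : HasValue (1 : RatFun K) z 1 := by
  simpa using hasValue_ofPoly (1 : MvPolynomial (Fin 2) K) z

namespace HasValue

variable {f g : RatFun K} {z : ℂ × ℂ} {a b : ℂ}

lemma add (hf : HasValue f z a) (hg : HasValue g z b) : HasValue (f + g) z (a + b) := by
  obtain ⟨p, q, hfe, hq, hqz, rfl⟩ := hasValue_iff.1 hf
  obtain ⟨r, s, hge, hs, hsz, rfl⟩ := hasValue_iff.1 hg
  have hq' : ofPoly q ≠ 0 := by simpa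
  have hs' : ofPoly s ≠ 0 := by simpa
  have h : f + g = ofPoly (p * s + q * r) / ofPoly (q * s) := by
    rw [hfe, hge, div_add_div _ _ hq' hs']; simp only [ofPoly_add, ofPoly_mul]
  convert hasValue_of_eq_div h (z := z) (by rw [polyEval_mul]; exact mul_ne_zero hqz hsz) using 1
  simp only [polyEval_add, polyEval_mul]
  field_simp

lemma mul (hf : HasValue f z a) (hg : HasValue g z b) : HasValue (f * g) z (a * b) := by
  obtain ⟨p, q, hfe, hq, hqz, rfl⟩ := hasValue_iff.1 hf
  obtain ⟨r, s, hge, hs, hsz, rfl⟩ := hasValue_iff.1 hg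
  have h : f * g = ofPoly (p * r) / ofPoly (q * s) := by
    rw [hfe, hge, div_mul_div_comm, ofPoly_mul, ofPoly_mul]
  convert hasValue_of_eq_div h (z := z) (by rw [polyEval_mul]; exact mul_ne_zero hqz hsz) using 1
  simp only [polyEval_mul]
  field_simp

lemma neg (hf : HasValue f z a) : HasValue (-f) z (-a) := by
  have h := (hasValue_const (-1 : K) z).mul hf
  rwa [show RatFun.const (-1 : K) = -1 by rw [RatFun.const, map_neg, map_one, ofPoly, map_neg,
    map_one], map_neg, map_one, neg_one_mul, neg_one_mul] at h

lemma sub (hf : HasValue f z a) (hg : HasValue g z b) : HasValue (f - g) z (a - b) := by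
  simpa only [sub_eq_add_neg] using hf.add hg.neg

lemma inv (hf : HasValue f z a) (ha : a ≠ 0) : HasValue f⁻¹ z a⁻¹ := by
  obtain ⟨p, q, hfe, hq, hqz, rfl⟩ := hasValue_iff.1 hf
  have h : f⁻¹ = ofPoly q / ofPoly p := by rw [hfe, inv_div]
  rw [inv_div]
  exact hasValue_of_eq_div h fun h0 => ha (by rw [h0, zero_div])

lemma div (hf : HasValue f z a) (hg : HasValue g z b) (hb : b ≠ 0) :
    HasValue (f / g) z (a / b) := by
  simpa only [div_eq_mul_inv] using hf.mul (hg.inv hb)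

lemma pow (hf : HasValue f z a) (n : ℕ) : HasValue (f ^ n) z (a ^ n) := by
  induction n with
  | zero => simpa using hasValue_one z
  | succ n ih => simpa only [pow_succ] using ih.mul hf

end HasValue

lemma RegularAt.partialD {f : RatFun K} {z : ℂ × ℂ} (i : Fin 2) (h : RegularAt f z) :
    RegularAt (partialD i f) z :=
  (hasValue_of_eq_div rfl (by rw [polyEval_pow]; exact pow_ne_zero _ h)).1

lemma evalAt_partialD {f : RatFun K} {z : ℂ × ℂ} (i : Fin 2) (h : RegularAt f z) :
    evalAt (RatFun.partialD i f) z = (polyEval (pderiv i (num f)) z * polyEval (den f) z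
      - polyEval (num f) z * polyEval (pderiv i (den f)) z) / polyEval (den f) z ^ 2 := by
  have := (hasValue_of_eq_div (f := RatFun.partialD i f) (z := z) rfl
    (by rw [polyEval_pow]; exact pow_ne_zero _ h)).2
  rw [this]
  simp only [polyEval_pow, polyEval_sub, polyEval_mul]

lemma hasDerivAt_polyEval (q : MvPolynomial (Fin 2) K) {a b : ℂ → ℂ} {a' b' t : ℂ}
    (ha : HasDerivAt a a' t) (hb : HasDerivAt b b' t) :
    HasDerivAt (fun s => polyEval q (a s, b s))
      (polyEval (pderiv 0 q) (a t, b t) * a' + polyEval (pderiv 1 q) (a t, b t) * b') t := by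
  induction q using MvPolynomial.induction_on with
  | C c => simpa using hasDerivAt_const t (algebraMap K ℂ c)
  | add p q hp hq =>
    simp only [polyEval_add, map_add]
    exact (hp.add hq).congr_deriv (by ring)
  | mul_X p i hp =>
    have hX : HasDerivAt (fun s => polyEval (X i : MvPolynomial (Fin 2) K) (a s, b s))
        (polyEval (pderiv 0 (X i : MvPolynomial (Fin 2) K)) (a t, b t) * a'
          + polyEval (pderiv 1 (X i : MvPolynomial (Fin 2) K)) (a t, b t) * b') t := by
      fin_cases i
      · simpa [polyEval, pderiv_X] using ha
      · simpa [polyEval, pderiv_X] using hb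
    simp only [polyEval_mul, Derivation.leibniz, smul_eq_mul, polyEval_add]
    exact (hp.mul hX).congr_deriv (by ring)

lemma hasDerivAt_evalAt {f : RatFun K} {a b : ℂ → ℂ} {a' b' t : ℂ}
    (ha : HasDerivAt a a' t) (hb : HasDerivAt b b' t) (hf : RegularAt f (a t, b t)) :
    HasDerivAt (fun s => evalAt f (a s, b s))
      (evalAt (partialD 0 f) (a t, b t) * a' + evalAt (partialD 1 f) (a t, b t) * b') t := by
  have h0 : polyEval (den f) (a t, b t) ≠ 0 := hf
  refine ((hasDerivAt_polyEval (num f) ha hb).div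
    (hasDerivAt_polyEval (den f) ha hb) hf).congr_deriv ?_
  rw [evalAt_partialD 0 hf, evalAt_partialD 1 hf]
  field_simp
  ring

lemma continuous_polyEval (q : MvPolynomial (Fin 2) K) : Continuous (polyEval q) := by
  induction q using MvPolynomial.induction_on with
  | C c => simpa [funext (polyEval_C c)] using continuous_const
  | add p q hp hq => exact (funext (polyEval_add p q)) ▸ hp.add hq
  | mul_X p i hp =>
    rw [funext (polyEval_mul p (X i))]
    refine hp.mul ?_
    fin_cases i
    · exact continuous_fst.congr fun z => by simp [polyEval]
    · exact continuous_snd.congr fun z => by simp [polyEval]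

lemma RegularAt.continuousAt {f : RatFun K} {z : ℂ × ℂ} (h : RegularAt f z) :
    ContinuousAt (evalAt f) z :=
  (continuous_polyEval _).continuousAt.div (continuous_polyEval _).continuousAt h

/-- Only the constants are annihilated by `D_x` if there is no rational first integral. -/
lemma _root_.NoRationalFirstIntegral.eq_const {F : RatFun K} (hF : NoRationalFirstIntegral F)
    {f : RatFun K} (hf : totalDx F f = 0) : ∃ c : K, f = const c := by
  set φ : MvPolynomial (Fin 2) K →+* MvPolynomial (Fin 2) ℂ := MvPolynomial.map (algebraMap K ℂ)
  have hφ : Function.Injective φ := MvPolynomial.map_injective _ (algebraMap K ℂ).injective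
  have hd : φ (den f) ≠ 0 := (map_ne_zero_iff φ hφ).2 (den_ne_zero f)
  have hd' : ofPoly (φ (den f)) ≠ 0 := by simpa
  have hcomm : ∀ (i : Fin 2) p, pderiv i (φ p) = φ (pderiv i p) := fun i p => pderiv_map
  -- Clearing denominators turns the equation into a polynomial identity, which can be transported
  -- to `ℂ[x,y]`.
  have hpoly : den F * (pderiv 0 (num f) * den f - num f * pderiv 0 (den f))
      + num F * (pderiv 1 (num f) * den f - num f * pderiv 1 (den f)) = 0 := by
    have hF0 := ofPoly_den_ne_zero F
    have hf0 := ofPoly_den_ne_zero f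
    rw [totalDx, ← num_div_den F, partialD, partialD] at hf
    rw [← ofPoly_eq_zero]
    simp only [ofPoly_pow] at hf
    simp only [ofPoly_add, ofPoly_mul]
    field_simp at hf
    rw [mul_zero] at hf
    rw [← hf]; ring
  obtain ⟨c, hc⟩ := hF (ofPoly (φ (num f)) / ofPoly (φ (den f))) (by
    rw [partialD_of_eq_div 0 hd rfl, partialD_of_eq_div 1 hd rfl, mul_div_assoc', mul_div_assoc',
      ← add_div, ← ofPoly_mul, ← ofPoly_mul, ← ofPoly_add]
    simp only [hcomm]
    have := congrArg φ hpoly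
    simp only [map_add, map_mul, map_sub, map_zero] at this
    rw [this]; simp)
  have h1 : φ (num f) = C c * φ (den f) := by
    rw [div_eq_iff hd', const, ← ofPoly_mul, ofPoly_inj] at hc
    exact hc
  -- The constant found over `ℂ` is brought back to `K`: one coefficient comparison in `num f = c ·
  -- den f`, at a monomial present in `den f`, expresses `c` as a quotient of elements of `K`.
  obtain ⟨m, hm⟩ := ne_zero_iff.1 (den_ne_zero f)
  refine ⟨coeff m (num f) / coeff m (den f), ?_⟩
  have h2 : c = algebraMap K ℂ (coeff m (num f) / coeff m (den f)) := by
    have := congrArg (coeff m) h1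
    rw [coeff_C_mul, coeff_map, coeff_map] at this
    rw [map_div₀, this, mul_div_cancel_right₀ _ (by simpa using hm)]
  have h3 : num f = C (coeff m (num f) / coeff m (den f)) * den f := by
    apply hφ
    rw [h1, h2, map_mul, map_C]
  rw [const, eq_comm, ← num_div_den f, eq_div_iff (ofPoly_den_ne_zero f), ← ofPoly_mul, num_div_den,
    ← h3]

end Evaluation

end RatFun

/-! ### Partial derivatives of analytic functions of two variables -/

section PartialDerivatives

variable {f g : ℂ × ℂ → ℂ} {w : ℂ × ℂ} {D : Set (ℂ × ℂ)}

lemma AnalyticAt.hasDerivAt_fst (h : AnalyticAt ℂ f w) :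
    HasDerivAt (fun t => f (t, w.2)) (fderiv ℂ f w (1, 0)) w.1 :=
  HasFDerivAt.comp_hasDerivAt (f := fun t => (t, w.2)) w.1 h.differentiableAt.hasFDerivAt
    ((hasDerivAt_id _).prodMk (hasDerivAt_const _ _))

lemma AnalyticAt.hasDerivAt_snd (h : AnalyticAt ℂ f w) :
    HasDerivAt (fun t => f (w.1, t)) (fderiv ℂ f w (0, 1)) w.2 :=
  HasFDerivAt.comp_hasDerivAt (f := fun t => (w.1, t)) w.2 h.differentiableAt.hasFDerivAt
    ((hasDerivAt_const _ _).prodMk (hasDerivAt_id _))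

lemma AnalyticAt.dFst_eq (h : AnalyticAt ℂ f w) : dFst f w = fderiv ℂ f w (1, 0) :=
  h.hasDerivAt_fst.deriv

lemma AnalyticAt.dSnd_eq (h : AnalyticAt ℂ f w) : dSnd f w = fderiv ℂ f w (0, 1) :=
  h.hasDerivAt_snd.deriv

lemma AnalyticAt.hasDerivAt_dFst (h : AnalyticAt ℂ f w) :
    HasDerivAt (fun t => f (t, w.2)) (dFst f w) w.1 := h.dFst_eq ▸ h.hasDerivAt_fst

lemma AnalyticAt.hasDerivAt_dSnd (h : AnalyticAt ℂ f w) :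
    HasDerivAt (fun t => f (w.1, t)) (dSnd f w) w.2 := h.dSnd_eq ▸ h.hasDerivAt_snd

lemma AnalyticAt.fderiv_apply (h : AnalyticAt ℂ f w) (v : ℂ × ℂ) :
    AnalyticAt ℂ (fun z => fderiv ℂ f z v) w :=
  ((ContinuousLinearMap.apply ℂ ℂ v).analyticAt _).comp h.fderiv

lemma AnalyticAt.dSnd (h : AnalyticAt ℂ f w) : AnalyticAt ℂ (dSnd f) w :=
  (h.fderiv_apply (0, 1)).congr (h.eventually_analyticAt.mono fun _ hz => hz.dSnd_eq.symm)

lemma eventually_fst {p : ℂ × ℂ → Prop} (h : ∀ᶠ z in nhds w, p z) :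
    ∀ᶠ t in nhds w.1, p (t, w.2) :=
  (Continuous.prodMk_left w.2).continuousAt.eventually h

lemma eventually_snd {p : ℂ × ℂ → Prop} (h : ∀ᶠ z in nhds w, p z) :
    ∀ᶠ t in nhds w.2, p (w.1, t) :=
  (Continuous.prodMk_right w.1).continuousAt.eventually h

lemma dFst_congr (h : f =ᶠ[nhds w] g) : dFst f w = dFst g w :=
  Filter.EventuallyEq.deriv_eq (eventually_fst h)

lemma dSnd_congr (h : f =ᶠ[nhds w] g) : dSnd f w = dSnd g w :=
  Filter.EventuallyEq.deriv_eq (eventually_snd h)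

lemma AnalyticAt.dFst_dSnd (h : AnalyticAt ℂ f w) :
    _root_.dFst (_root_.dSnd f) w = _root_.dSnd (_root_.dFst f) w := by
  have key : ∀ v, HasFDerivAt (fun z => fderiv ℂ f z v)
      ((ContinuousLinearMap.apply ℂ ℂ v).comp (fderiv ℂ (fderiv ℂ f) w)) w := fun v =>
    (ContinuousLinearMap.apply ℂ ℂ v).hasFDerivAt.comp w
      h.fderiv.differentiableAt.hasFDerivAt
  have hsymm : IsSymmSndFDerivAt ℂ f w :=
    (h.contDiffAt (n := 2)).isSymmSndFDerivAt (by simp)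
  rw [dFst_congr (h.eventually_analyticAt.mono fun _ hz => hz.dSnd_eq),
    dSnd_congr (h.eventually_analyticAt.mono fun _ hz => hz.dFst_eq),
    (h.fderiv_apply _).dFst_eq, (h.fderiv_apply _).dSnd_eq, (key _).fderiv, (key _).fderiv]
  exact hsymm (1, 0) (0, 1)

lemma dSndIter_succ (n : ℕ) (f : ℂ × ℂ → ℂ) : dSndIter (n + 1) f = dSnd (dSndIter n f) := by
  funext w
  simp only [dSndIter, dSnd, iteratedDeriv_succ]

lemma dSndIter_zero (f : ℂ × ℂ → ℂ) : dSndIter 0 f = f := by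
  funext w
  simp [dSndIter]

lemma AnalyticAt.dSndIter (h : AnalyticAt ℂ f w) (n : ℕ) : AnalyticAt ℂ (dSndIter n f) w := by
  induction n with
  | zero => rwa [dSndIter_zero]
  | succ n ih => rw [dSndIter_succ]; exact ih.dSnd

lemma AnalyticAt.dFst_dSndIter (h : AnalyticAt ℂ f w) (n : ℕ) :
    _root_.dFst (_root_.dSndIter n f) w = _root_.dSndIter n (_root_.dFst f) w := by
  -- The equality is proved near `w`, not only at `w`, because the inductive step differentiates it.
  have key : ∀ n, ∀ᶠ z in nhds w,
      _root_.dFst (_root_.dSndIter n f) z = _root_.dSndIter n (_root_.dFst f) z := by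
    intro n
    induction n with
    | zero => simp [dSndIter_zero]
    | succ n ih =>
      filter_upwards [ih.eventually_nhds, h.eventually_analyticAt] with z hz hf
      rw [dSndIter_succ, dSndIter_succ, (hf.dSndIter n).dFst_dSnd]
      exact dSnd_congr hz
  exact (key n).self_of_nhds

end PartialDerivatives

/-! ### The integrating factor along a general solution -/

namespace IsDarbouxianIntegral

open RatFun

variable {K : Type*} [Field K] [Algebra K ℂ] {F G R : RatFun K} {k : ℕ} {Ω : Set (ℂ × ℂ)}
  {Φ : ℂ × ℂ → ℂ} {D : Set (ℂ × ℂ)} {y I : ℂ × ℂ → ℂ} {w : ℂ × ℂ}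

lemma mem_nhds (h : IsDarbouxianIntegral F G R k Ω Φ D y I) (hw : w ∈ D) : D ∈ nhds w :=
  h.solution.isOpen.mem_nhds hw

lemma analyticAt_Phi (h : IsDarbouxianIntegral F G R k Ω Φ D y I) (hw : w ∈ D) :
    AnalyticAt ℂ Φ (w.1, y w) := h.darbouxian.analytic _ (h.mem w hw)

/-- Differentiate `Φ(x, y(x,h)) = h` in `h`. It follows that `U` has no zero along the solution and
that `∂_h` acts on functions of `(x, y)` as `D_h = U⁻¹ ∂_y`. -/
lemma factor_mul_dSnd (h : IsDarbouxianIntegral F G R k Ω Φ D y I) (hw : w ∈ D) :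
    dSnd Φ (w.1, y w) * dSnd y w = 1 := by
  have h1 : HasDerivAt (fun t => Φ (w.1, y (w.1, t))) (dSnd Φ (w.1, y w) * dSnd y w) w.2 :=
    HasDerivAt.comp (h₂ := fun s => Φ (w.1, s)) w.2 (h.analyticAt_Phi hw).hasDerivAt_dSnd
      (h.solution.analytic w hw).hasDerivAt_dSnd
  have h2 : (fun t => Φ (w.1, y (w.1, t))) =ᶠ[nhds w.2] fun t => t :=
    eventually_snd (Filter.eventually_of_mem (h.mem_nhds hw) fun z hz => h.level z hz)
  exact (h1.congr_of_eventuallyEq h2.symm).unique (hasDerivAt_id' w.2)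

lemma factor_ne_zero (h : IsDarbouxianIntegral F G R k Ω Φ D y I) (hw : w ∈ D) :
    dSnd Φ (w.1, y w) ≠ 0 := left_ne_zero_of_mul_eq_one (h.factor_mul_dSnd hw)

lemma hasDerivAt_fst (h : IsDarbouxianIntegral F G R k Ω Φ D y I) (hw : w ∈ D) {f : RatFun K}
    (hf : f.RegularAt (w.1, y w)) :
    HasDerivAt (fun t => f.evalAt (t, y (t, w.2))) ((totalDx F f).evalAt (w.1, y w)) w.1 := by
  have h1 := hasDerivAt_evalAt (a := fun t => t) (b := fun t => y (t, w.2)) (hasDerivAt_id' w.1)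
    (h.solution.analytic w hw).hasDerivAt_dFst hf
  refine h1.congr_deriv ?_
  obtain ⟨hF, hy⟩ := h.solution.solves w hw
  have h2 := ((hf.partialD 0).hasValue.add (hF.hasValue.mul (hf.partialD 1).hasValue)).2
  rw [totalDx, h2, hy]
  ring

lemma hasDerivAt_snd (h : IsDarbouxianIntegral F G R k Ω Φ D y I) (hw : w ∈ D) {f : RatFun K}
    (hf : f.RegularAt (w.1, y w)) :
    HasDerivAt (fun t => f.evalAt (w.1, y (w.1, t)))
      ((dSnd Φ (w.1, y w))⁻¹ * (partialD 1 f).evalAt (w.1, y w)) w.2 := by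
  have h1 := hasDerivAt_evalAt (a := fun _ => w.1) (b := fun t => y (w.1, t))
    (hasDerivAt_const w.2 w.1) (h.solution.analytic w hw).hasDerivAt_dSnd hf
  refine h1.congr_deriv ?_
  rw [eq_inv_of_mul_eq_one_right (h.factor_mul_dSnd hw)]
  simp only [Prod.mk.eta]
  ring

lemma analyticAt_factor (h : IsDarbouxianIntegral F G R k Ω Φ D y I) (hw : w ∈ D) :
    AnalyticAt ℂ (fun z => dSnd Φ (z.1, y z)) w :=
  AnalyticAt.comp₂ (h := dSnd Φ) (h.analyticAt_Phi hw).dSnd analyticAt_fst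
    (h.solution.analytic w hw)

lemma hasValue_R (h : IsDarbouxianIntegral F G R k Ω Φ D y I) (hw : w ∈ D) :
    R.HasValue (w.1, y w) (dSnd Φ (w.1, y w) ^ k) :=
  ⟨(h.darbouxian.power _ (h.mem w hw)).1, (h.darbouxian.power _ (h.mem w hw)).2.symm⟩

/-- The logarithmic derivative of `U` from that of `R = U ^ k`. -/
lemma logDeriv_root {k : ℕ} (hk : 1 ≤ k) {U r : ℂ → ℂ} {U' r' t : ℂ} (hU : HasDerivAt U U' t)
    (hr : HasDerivAt r r' t) (h0 : U t ≠ 0) (h : ∀ᶠ s in nhds t, U s ^ k = r s) :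
    U' = U t * (r' / (k * U t ^ k)) := by
  have h1 := (hU.pow k).unique (hr.congr_of_eventuallyEq h)
  obtain ⟨m, rfl⟩ := Nat.exists_eq_add_of_le' hk
  have h2 : ((m + 1 : ℕ) : ℂ) ≠ 0 := Nat.cast_ne_zero.2 (by omega)
  rw [← h1, Nat.add_sub_cancel]
  field_simp
  ring

/-- Both `U⁻¹ D_x U` and `U⁻¹ ∂_y U` have the shape `f / (kR)`. The denominator does not vanish
along the solution because `R = U^k` there. -/
lemma hasValue_log (h : IsDarbouxianIntegral F G R k Ω Φ D y I) (hw : w ∈ D) {f : RatFun K}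
    (hf : f.RegularAt (w.1, y w)) :
    (f / (k * R)).HasValue (w.1, y w) (f.evalAt (w.1, y w) / (k * dSnd Φ (w.1, y w) ^ k)) :=
  hf.hasValue.div ((hasValue_natCast k _).mul (h.hasValue_R hw))
    (mul_ne_zero (Nat.cast_ne_zero.2 (by have := h.darbouxian.k_pos; omega))
      (pow_ne_zero _ (h.factor_ne_zero hw)))

lemma regularAt_totalDx (h : IsDarbouxianIntegral F G R k Ω Φ D y I) (hw : w ∈ D) {f : RatFun K}
    (hf : f.RegularAt (w.1, y w)) : (totalDx F f).RegularAt (w.1, y w) :=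
  ((hf.partialD 0).hasValue.add
    ((h.solution.solves w hw).1.hasValue.mul (hf.partialD 1).hasValue)).1

lemma hasDerivAt_factor_fst (h : IsDarbouxianIntegral F G R k Ω Φ D y I) (hw : w ∈ D) :
    HasDerivAt (fun t => dSnd Φ (t, y (t, w.2)))
      (dSnd Φ (w.1, y w) * (totalDx F R / (k * R)).evalAt (w.1, y w)) w.1 := by
  have h1 := (h.analyticAt_factor hw).hasDerivAt_dFst
  have hR := (h.hasValue_R hw).1
  have h2 := logDeriv_root h.darbouxian.k_pos h1 (h.hasDerivAt_fst hw hR) (h.factor_ne_zero hw)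
    (eventually_fst (Filter.eventually_of_mem (h.mem_nhds hw) fun z hz => (h.hasValue_R hz).2.symm))
  rw [(h.hasValue_log hw (h.regularAt_totalDx hw hR)).2]
  exact h1.congr_deriv h2

/-- No factor `U` appears, in contrast with the derivative in `x`: the `U` of the logarithmic
derivative cancels the `U⁻¹` of `D_h`. -/
lemma hasDerivAt_factor_snd (h : IsDarbouxianIntegral F G R k Ω Φ D y I) (hw : w ∈ D) :
    HasDerivAt (fun t => dSnd Φ (w.1, y (w.1, t)))
      ((partialD 1 R / (k * R)).evalAt (w.1, y w)) w.2 := by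
  have h1 := (h.analyticAt_factor hw).hasDerivAt_dSnd
  have hR := (h.hasValue_R hw).1
  have h2 := logDeriv_root h.darbouxian.k_pos h1 (h.hasDerivAt_snd hw hR) (h.factor_ne_zero hw)
    (eventually_snd (Filter.eventually_of_mem (h.mem_nhds hw) fun z hz => (h.hasValue_R hz).2.symm))
  rw [(h.hasValue_log hw (hR.partialD 1)).2]
  refine h1.congr_deriv (h2.trans ?_)
  have := h.factor_ne_zero hw
  simp only [Prod.mk.eta]
  field_simp

end IsDarbouxianIntegral

/-- The rational functions `g_n` with `D_h^n G = U^{-n} g_n`, where `v = U⁻¹ ∂_y U`. -/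
noncomputable def iterDh {K : Type*} [Field K] (v G : RatFun K) : ℕ → RatFun K
  | 0 => G
  | n + 1 => RatFun.partialD 1 (iterDh v G n) - (n : RatFun K) * v * iterDh v G n

/-! ### Derivatives of the integral and generic points of a solution. -/

namespace IsDarbouxianIntegral

open RatFun

variable {K : Type*} [Field K] [Algebra K ℂ] {F G R : RatFun K} {k : ℕ} {Ω : Set (ℂ × ℂ)}
  {Φ : ℂ × ℂ → ℂ} {D : Set (ℂ × ℂ)} {y I : ℂ × ℂ → ℂ} {w : ℂ × ℂ}

/-- Partial derivatives commute, so the left side is `∂_h^n` of `G` along the solution. The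
induction step is `∂_h (U^{-n} g) = U^{-(n+1)} (∂_y g - n v g)` with `v = U⁻¹ ∂_y U`. -/
lemma dFst_dSndIter (h : IsDarbouxianIntegral F G R k Ω Φ D y I) (n : ℕ) (hw : w ∈ D) :
    (iterDh (partialD 1 R / ((k : RatFun K) * R)) G n).RegularAt (w.1, y w) ∧
      dFst (dSndIter n I) w = (dSnd Φ (w.1, y w) ^ n)⁻¹ *
        (iterDh (partialD 1 R / ((k : RatFun K) * R)) G n).evalAt (w.1, y w) := by
  rw [(h.analytic w hw).dFst_dSndIter]
  induction n generalizing w with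
  | zero => simpa [dSndIter_zero, iterDh] using h.integral w hw
  | succ n ih =>
    obtain ⟨hreg, -⟩ := ih hw
    set g := iterDh (partialD 1 R / ((k : RatFun K) * R)) G n with hg
    have hv := h.hasValue_log hw ((h.hasValue_R hw).1.partialD 1)
    have h1 := (hreg.partialD 1).hasValue.sub
      (((hasValue_natCast n _).mul hv.1.hasValue).mul hreg.hasValue)
    refine ⟨h1.1, ?_⟩
    rw [dSndIter_succ, iterDh, ← hg, h1.2,
      dSnd_congr (Filter.eventually_of_mem (h.mem_nhds hw) fun z hz => (ih hz).2)]
    have hU := h.factor_ne_zero hw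
    have h2 : HasDerivAt (fun t => (dSnd Φ (w.1, y (w.1, t)) ^ n)⁻¹ * g.evalAt (w.1, y (w.1, t)))
      _ w.2 := (((h.hasDerivAt_factor_snd hw).pow n).inv (pow_ne_zero _ hU)).mul
      (h.hasDerivAt_snd hw hreg)
    refine h2.deriv.trans ?_
    simp only [Prod.mk.eta, Pi.inv_apply, Pi.pow_apply]
    -- The derivative of `U^n` carries the truncated exponent `n - 1`.
    rcases n with _ | n
    · simp
    · rw [Nat.add_sub_cancel]
      field_simp
      ring

/-- A nonzero polynomial does not vanish identically along a general solution. -/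
lemma exists_polyEval_ne_zero (h : IsDarbouxianIntegral F G R k Ω Φ D y I)
    {T : MvPolynomial (Fin 2) K} (hT : T ≠ 0) {W : Set (ℂ × ℂ)} (hW : IsOpen W) (hWD : W ⊆ D)
    (hne : W.Nonempty) : ∃ w ∈ W, polyEval T (w.1, y w) ≠ 0 := by
  have : CharZero K := (algebraMap K ℂ).charZero
  by_contra! hc
  refine hT ?_
  clear hT
  generalize hn : T.totalDegree = n
  induction n using Nat.strong_induction_on generalizing T with
  | _ n ih =>
  have hTC : T = C (coeff 0 T) := by
    rcases Nat.eq_zero_or_pos n with rfl | hpos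
    · exact totalDegree_eq_zero_iff_eq_C.1 hn
    -- If `T` vanishes along the solution, its derivative in `h` gives `∂_y T = 0` there, since `∂_h
    -- y ≠ 0`, and then its derivative in `x` gives `∂_x T = 0`. By induction on the degree both
    -- partials are zero polynomials; in characteristic zero `T` is then constant.
    have hx : ∀ w ∈ W, HasDerivAt (fun t => polyEval T (t, y (t, w.2))) 0 w.1 := fun w hw =>
      (hasDerivAt_const w.1 (0 : ℂ)).congr_of_eventuallyEq
        (eventually_fst (Filter.eventually_of_mem (hW.mem_nhds hw) fun z hz => hc z hz))
    have hy : ∀ w ∈ W, HasDerivAt (fun t => polyEval T (w.1, y (w.1, t))) 0 w.2 := fun w hw =>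
      (hasDerivAt_const w.2 (0 : ℂ)).congr_of_eventuallyEq
        (eventually_snd (Filter.eventually_of_mem (hW.mem_nhds hw) fun z hz => hc z hz))
    have h1 : ∀ w ∈ W, polyEval (pderiv 1 T) (w.1, y w) = 0 := fun w hw => by
      have := (hasDerivAt_polyEval T (hasDerivAt_const w.2 w.1)
        (h.solution.analytic w (hWD hw)).hasDerivAt_dSnd).unique (hy w hw)
      simpa [right_ne_zero_of_mul_eq_one (h.factor_mul_dSnd (hWD hw))] using this
    have h0 : ∀ w ∈ W, polyEval (pderiv 0 T) (w.1, y w) = 0 := fun w hw => by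
      have := (hasDerivAt_polyEval T (hasDerivAt_id' w.1)
        (h.solution.analytic w (hWD hw)).hasDerivAt_dFst).unique (hx w hw)
      simpa [h1 w hw] using this
    have hp : ∀ i, pderiv i T = 0 := by
      intro i
      refine ih _ ?_ (T := pderiv i T) ?_ rfl
      · have := totalDegree_pderiv_le i T
        omega
      · fin_cases i
        · exact h0
        · exact h1
    ext m
    rw [coeff_C]
    split_ifs with hm
    · rw [hm]
    · obtain ⟨i, hi⟩ := Finsupp.ne_iff.1 (Ne.symm hm)
      have h2 := congrArg (coeff (m - Finsupp.single i 1)) (hp i)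
      rw [coeff_pderiv, coeff_zero, tsub_add_cancel_of_le
        (Finsupp.single_le_iff.2 (Nat.one_le_iff_ne_zero.2 hi))] at h2
      exact (mul_eq_zero.1 h2).resolve_right (Nat.cast_add_one_ne_zero _)
  obtain ⟨w, hw⟩ := hne
  have h3 := hc w hw
  rw [hTC, polyEval_C, map_eq_zero] at h3
  rw [hTC, h3, map_zero]

end IsDarbouxianIntegral

/-! ### Relations between the integral and rational functions -/

section Relations

open RatFun

variable {K : Type*} [Field K]

/-- A common multiple of the denominators of the first `n` entries. -/
lemma exists_regular (v : ℕ → RatFun K) (n : ℕ) [Algebra K ℂ] :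
    ∃ T : MvPolynomial (Fin 2) K, T ≠ 0 ∧
      ∀ z, polyEval T z ≠ 0 → ∀ c < n, RegularAt (v c) z := by
  refine ⟨∏ c ∈ Finset.range n, den (v c), Finset.prod_ne_zero_iff.2 fun c _ => den_ne_zero _,
    fun z hz c hc => ?_⟩
  rw [polyEval, map_prod] at hz
  exact Finset.prod_ne_zero_iff.1 hz c (Finset.mem_range.2 hc)

/-- The operation on rows that corresponds to `∂_x` on relations. -/
noncomputable def rowDeriv (F u : RatFun K) (m e : ℕ) (τ v : ℕ → RatFun K) : ℕ → RatFun K :=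
  fun c => if c = m + 1 then
    totalDx F (v c) - (e : RatFun K) * v c * u - ∑ i ∈ Finset.range (m + 1), v i * τ i
  else totalDx F (v c)

lemma rowDeriv_add (F u : RatFun K) (m e : ℕ) (τ v v' : ℕ → RatFun K) :
    rowDeriv F u m e τ (v + v') = rowDeriv F u m e τ v + rowDeriv F u m e τ v' := by
  funext c
  simp only [rowDeriv, Pi.add_apply, totalDx_add, add_mul, Finset.sum_add_distrib]
  split_ifs <;> ring

/-- The Leibniz rule of a connection over `D_x`. Although the map is not linear over `K(x,y)`, this
rule and additivity allow stability of a span to be checked on its generators. -/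
lemma rowDeriv_smul (F u : RatFun K) (m e : ℕ) (τ v : ℕ → RatFun K) (f : RatFun K) :
    rowDeriv F u m e τ (f • v) = totalDx F f • v + f • rowDeriv F u m e τ v := by
  funext c
  simp only [rowDeriv, Pi.add_apply, Pi.smul_apply, smul_eq_mul, totalDx_mul, mul_assoc,
    ← Finset.mul_sum]
  split_ifs <;> ring

variable [Algebra K ℂ]

/-- The relation `∑_c v_c ∂_h^{k(m-c)+e} I = U^{-e} v_{m+1}` holds at the point `w`. -/
def RelationAt (k m e : ℕ) (Φ : ℂ × ℂ → ℂ) (y I : ℂ × ℂ → ℂ) (v : ℕ → RatFun K)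
    (w : ℂ × ℂ) : Prop :=
  ∑ c ∈ Finset.range (m + 1), evalAt (v c) (w.1, y w) * dSndIter (k * (m - c) + e) I w
    = (dSnd Φ (w.1, y w) ^ e)⁻¹ * evalAt (v (m + 1)) (w.1, y w)

/-- The rows whose relation holds generically. -/
def relations (K : Type*) [Field K] [Algebra K ℂ] (k m e : ℕ) (Φ : ℂ × ℂ → ℂ) (D : Set (ℂ × ℂ))
    (y I : ℂ × ℂ → ℂ) : Submodule (RatFun K) (ℕ → RatFun K) where
  carrier := {v | ∃ T : MvPolynomial (Fin 2) K, T ≠ 0 ∧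
    ∀ w ∈ D, polyEval T (w.1, y w) ≠ 0 → RelationAt k m e Φ y I v w}
  zero_mem' := ⟨1, one_ne_zero, fun w _ _ => by
    simp [RelationAt, (hasValue_zero (K := K) (w.1, y w)).2]⟩
  add_mem' := by
    rintro v v' ⟨T, hT, h⟩ ⟨T', hT', h'⟩
    obtain ⟨S, hS, hr⟩ := exists_regular v (m + 2)
    obtain ⟨S', hS', hr'⟩ := exists_regular v' (m + 2)
    -- Evaluation is additive only where all entries are regular, so their denominators join the
    -- exceptional polynomial.
    refine ⟨T * T' * (S * S'), mul_ne_zero (mul_ne_zero hT hT') (mul_ne_zero hS hS'),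
      fun w hw hz => ?_⟩
    simp only [polyEval_mul, mul_ne_zero_iff] at hz
    obtain ⟨⟨hz1, hz2⟩, hz3, hz4⟩ := hz
    have hv : ∀ c < m + 2, evalAt ((v + v') c) (w.1, y w)
        = evalAt (v c) (w.1, y w) + evalAt (v' c) (w.1, y w) := fun c hc =>
      ((hr _ hz3 c hc).hasValue.add (hr' _ hz4 c hc).hasValue).2
    rw [RelationAt, hv _ (by omega), mul_add, ← h w hw hz1, ← h' w hw hz2,
      ← Finset.sum_add_distrib]
    refine Finset.sum_congr rfl fun c hc => ?_
    rw [hv c (by have := Finset.mem_range.1 hc; omega), add_mul]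
  smul_mem' := by
    rintro f v ⟨T, hT, h⟩
    obtain ⟨S, hS, hr⟩ := exists_regular v (m + 2)
    refine ⟨T * (S * den f), mul_ne_zero hT (mul_ne_zero hS (den_ne_zero f)), fun w hw hz => ?_⟩
    simp only [polyEval_mul, mul_ne_zero_iff] at hz
    obtain ⟨hz1, hz2, hz3⟩ := hz
    have hv : ∀ c < m + 2, evalAt ((f • v) c) (w.1, y w)
        = evalAt f (w.1, y w) * evalAt (v c) (w.1, y w) := fun c hc =>
      ((show RegularAt f (w.1, y w) from hz3).hasValue.mul (hr _ hz2 c hc).hasValue).2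
    rw [RelationAt, hv _ (by omega), mul_left_comm, ← h w hw hz1, Finset.mul_sum]
    refine Finset.sum_congr rfl fun c hc => ?_
    rw [hv c (by have := Finset.mem_range.1 hc; omega), mul_assoc]

namespace IsDarbouxianIntegral

variable {F G R : RatFun K} {k : ℕ} {Ω : Set (ℂ × ℂ)} {Φ : ℂ × ℂ → ℂ} {D : Set (ℂ × ℂ)}
  {y I : ℂ × ℂ → ℂ} {w : ℂ × ℂ} {m e : ℕ} {v : ℕ → RatFun K}

lemma continuousAt_pt (h : IsDarbouxianIntegral F G R k Ω Φ D y I) (hw : w ∈ D) :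
    ContinuousAt (fun z : ℂ × ℂ => (z.1, y z)) w :=
  continuousAt_fst.prodMk (h.solution.analytic w hw).continuousAt

/-- A relation that holds generically holds wherever its coefficients are regular. -/
lemma relationAt (h : IsDarbouxianIntegral F G R k Ω Φ D y I)
    (hv : v ∈ relations K k m e Φ D y I) (hw : w ∈ D)
    (hreg : ∀ c < m + 2, RegularAt (v c) (w.1, y w)) : RelationAt k m e Φ y I v w := by
  obtain ⟨T, hT, hrel⟩ := hv
  by_contra hne
  have hc : ∀ c < m + 2, ContinuousAt (fun z : ℂ × ℂ => evalAt (v c) (z.1, y z)) w := fun c hc =>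
    ContinuousAt.comp (f := fun z : ℂ × ℂ => (z.1, y z)) (hreg c hc).continuousAt
      (h.continuousAt_pt hw)
  have h1 : ContinuousAt (fun z => ∑ c ∈ Finset.range (m + 1),
      evalAt (v c) (z.1, y z) * dSndIter (k * (m - c) + e) I z) w :=
    tendsto_finsetSum _ fun c hc' => (hc c (by have := Finset.mem_range.1 hc'; omega)).mul
      ((h.analytic w hw).dSndIter _).continuousAt
  have h2 : ContinuousAt
      (fun z => (dSnd Φ (z.1, y z) ^ e)⁻¹ * evalAt (v (m + 1)) (z.1, y z)) w :=
    (((h.analyticAt_factor hw).continuousAt.pow e).inv₀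
      (pow_ne_zero _ (h.factor_ne_zero hw))).mul (hc _ (by omega))
  -- Both sides are continuous at `w`. Were they different there, they would differ on a whole
  -- neighbourhood, which contains a point where `T` does not vanish.
  have h3 := (h1.sub h2).eventually_ne (sub_ne_zero.2 hne)
  obtain ⟨W, hW, hWo, hwW⟩ := eventually_nhds_iff.1 (h3.and (h.mem_nhds hw))
  obtain ⟨z, hz, hTz⟩ := h.exists_polyEval_ne_zero hT hWo (fun z hz => (hW z hz).2) ⟨w, hwW⟩
  exact (hW z hz).1 (sub_eq_zero.2 (hrel z (hW z hz).2 hTz))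

/-- Differentiation of a relation with respect to `x`. -/
lemma rowDeriv_mem (h : IsDarbouxianIntegral F G R k Ω Φ D y I)
    {τ : ℕ → RatFun K} (hτ : ∀ c < m + 1, τ c = (R ^ (m - c))⁻¹ *
      iterDh (partialD 1 R / ((k : RatFun K) * R)) G (k * (m - c) + e))
    (hv : v ∈ relations K k m e Φ D y I) :
    rowDeriv F (totalDx F R / ((k : RatFun K) * R)) m e τ v ∈ relations K k m e Φ D y I := by
  obtain ⟨T, hT, hrel⟩ := hv
  obtain ⟨S, hS, hr⟩ := exists_regular v (m + 2)
  refine ⟨T * S, mul_ne_zero hT hS, fun w hw hz => ?_⟩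
  simp only [polyEval_mul, mul_ne_zero_iff] at hz
  obtain ⟨hz1, hz2⟩ := hz
  have hU := h.factor_ne_zero hw
  -- The exceptional set is avoided on a neighbourhood, so the two sides of the relation may be
  -- differentiated in `x`.
  have hnear : ∀ᶠ z in nhds w, RelationAt k m e Φ y I v z := by
    have hc : ContinuousAt (fun z : ℂ × ℂ => polyEval T (z.1, y z)) w :=
      ContinuousAt.comp (f := fun z : ℂ × ℂ => (z.1, y z)) (continuous_polyEval T).continuousAt
        (h.continuousAt_pt hw)
    filter_upwards [hc.eventually_ne hz1, h.mem_nhds hw] with z h1 h2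
    exact hrel z h2 h1
  have h1 : HasDerivAt (fun t => ∑ c ∈ Finset.range (m + 1),
      evalAt (v c) (t, y (t, w.2)) * dSndIter (k * (m - c) + e) I (t, w.2)) _ w.1 :=
    HasDerivAt.fun_sum fun c hc =>
      (h.hasDerivAt_fst hw (hr _ hz2 c (by have := Finset.mem_range.1 hc; omega))).mul
        ((h.analytic w hw).dSndIter (k * (m - c) + e)).hasDerivAt_dFst
  have h2 : HasDerivAt
      (fun t => (dSnd Φ (t, y (t, w.2)) ^ e)⁻¹ * evalAt (v (m + 1)) (t, y (t, w.2))) _ w.1 :=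
    (((h.hasDerivAt_factor_fst hw).pow e).inv (pow_ne_zero _ hU)).mul
      (h.hasDerivAt_fst hw (hr _ hz2 (m + 1) (by omega)))
  have h3 := h1.unique (h2.congr_of_eventuallyEq (eventually_fst hnear))
  simp only [Prod.mk.eta, Pi.inv_apply, Pi.pow_apply, Finset.sum_add_distrib] at h3
  have hu := (h.hasValue_log hw (h.regularAt_totalDx hw (h.hasValue_R hw).1)).1.hasValue
  -- The factor `R^{-(m-c)}` is `U^{-k(m-c)}`; what remains of `U^{-(k(m-c)+e)}` is compensated by
  -- `U^e`.
  have hτv : ∀ c < m + 1, (τ c).HasValue (w.1, y w)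
      (dSnd Φ (w.1, y w) ^ e * dFst (dSndIter (k * (m - c) + e) I) w) := by
    intro c hc
    obtain ⟨hg1, hg2⟩ := h.dFst_dSndIter (k * (m - c) + e) hw
    have := (((h.hasValue_R hw).pow (m - c)).inv
      (pow_ne_zero _ (pow_ne_zero _ hU))).mul hg1.hasValue
    rw [← hτ c hc] at this
    convert this using 1
    rw [hg2, pow_add, pow_mul]
    field_simp
  have hsum : ∀ n ≤ m + 1, (∑ i ∈ Finset.range n, v i * τ i).HasValue (w.1, y w)
      (∑ i ∈ Finset.range n, evalAt (v i) (w.1, y w) *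
        (dSnd Φ (w.1, y w) ^ e * dFst (dSndIter (k * (m - i) + e) I) w)) := by
    intro n hn
    induction n with
    | zero => simpa using hasValue_zero _
    | succ n ih =>
      rw [Finset.sum_range_succ, Finset.sum_range_succ]
      exact (ih (by omega)).add ((hr _ hz2 n (by omega)).hasValue.mul (hτv n (by omega)))
  have hlast := (((h.regularAt_totalDx hw (hr _ hz2 (m + 1) (by omega))).hasValue.sub
    (((hasValue_natCast e _).mul (hr _ hz2 (m + 1) (by omega)).hasValue).mul hu)).sub
    (hsum (m + 1) le_rfl)).2
  rw [RelationAt]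
  have hcoef : ∀ c ∈ Finset.range (m + 1), rowDeriv F (totalDx F R / ((k : RatFun K) * R)) m e τ v c
      = totalDx F (v c) := fun c hc => if_neg (by have := Finset.mem_range.1 hc; omega)
  rw [Finset.sum_congr rfl fun c hc => by rw [hcoef c hc], rowDeriv, if_pos rfl, hlast,
    eq_sub_of_add_eq h3]
  have hpull : ∑ i ∈ Finset.range (m + 1), evalAt (v i) (w.1, y w) *
        (dSnd Φ (w.1, y w) ^ e * dFst (dSndIter (k * (m - i) + e) I) w)
      = dSnd Φ (w.1, y w) ^ e * ∑ i ∈ Finset.range (m + 1), evalAt (v i) (w.1, y w) *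
        dFst (dSndIter (k * (m - i) + e) I) w := by
    rw [Finset.mul_sum]
    exact Finset.sum_congr rfl fun _ _ => by ring
  rw [hpull]
  rcases e with _ | e
  · simp
  · rw [Nat.add_sub_cancel]
    field_simp
    ring

end IsDarbouxianIntegral

end Relations

/-! ### Echelon bases -/

section Echelon

variable {F : Type*} [Field F]

/-- A list, seen as a vector extended by zeros. -/
def rowVec (row : List F) : ℕ → F := fun c => row.getD c 0

/-- The span of the first `r` vectors of a sequence. -/
def spanLT (L : ℕ → ℕ → F) (r : ℕ) : Submodule F (ℕ → F) :=
  Submodule.span F (Set.range fun i : Fin r => L i)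

lemma spanLT_mono (L : ℕ → ℕ → F) {r s : ℕ} (h : r ≤ s) : spanLT L r ≤ spanLT L s := by
  refine Submodule.span_mono ?_
  rintro _ ⟨i, rfl⟩
  exact ⟨Fin.castLE h i, rfl⟩

lemma mem_spanLT (L : ℕ → ℕ → F) {i r : ℕ} (h : i < r) : L i ∈ spanLT L r :=
  Submodule.subset_span ⟨⟨i, h⟩, rfl⟩

/-- `B` is obtained from the vectors `L 0, L 1, …` of length `n` by incremental elimination; its
entries are the reduced rows with their pivots. -/
structure Echelon (n : ℕ) (L : ℕ → ℕ → F) (B : List (ℕ × List F)) : Prop where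
  pairwise : B.Pairwise fun a b => b.2.getD a.1 0 = 0
  lead : ∀ a ∈ B, a.1 < n ∧ a.2.length = n ∧ a.2.getD a.1 0 ≠ 0 ∧ ∀ c < a.1, a.2.getD c 0 = 0
  span : ∀ i (h : i < B.length), rowVec B[i].2 - L i ∈ spanLT L i

/-- The minor of the vectors `L 0, L 1, …` on the pivot columns of `B`. -/
def pivotMinor (L : ℕ → ℕ → F) (B : List (ℕ × List F)) : Matrix (Fin B.length) (Fin B.length) F :=
  Matrix.of fun i j => L i B[j].1

namespace Echelon

variable {n : ℕ} {L : ℕ → ℕ → F} {B : List (ℕ × List F)}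

lemma nil : Echelon n L [] := ⟨List.Pairwise.nil, by simp, by simp⟩

lemma mem_span (h : Echelon n L B) {i : ℕ} (hi : i < B.length) :
    rowVec B[i].2 ∈ spanLT L (i + 1) := by
  have := (spanLT L (i + 1)).add_mem (spanLT_mono L (Nat.le_succ i) (h.span i hi))
    (mem_spanLT L (Nat.lt_succ_self i))
  rwa [sub_add_cancel] at this

lemma mem_span_of_mem (h : Echelon n L B) {b : ℕ × List F} (hb : b ∈ B) :
    rowVec b.2 ∈ spanLT L B.length := by
  obtain ⟨i, hi, rfl⟩ := List.getElem_of_mem hb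
  exact spanLT_mono L hi (h.mem_span hi)

/-- On the pivot columns the stored rows form an upper triangular matrix with nonzero diagonal: a
later row vanishes at earlier pivots. These rows are combinations of the `L i`, so the matrix
factors through `pivotMinor`. Pivots are ordered by discovery and need not increase. -/
lemma det_ne_zero (h : Echelon n L B) : (pivotMinor L B).det ≠ 0 := by
  have hT : ∀ i : Fin B.length, ∃ c : Fin B.length → F, ∑ j, c j • L j = rowVec B[i].2 :=
    fun i => (Submodule.mem_span_range_iff_exists_fun F).1
      (h.mem_span_of_mem (List.getElem_mem i.2))
  choose T hT using hT
  set A : Matrix (Fin B.length) (Fin B.length) F := Matrix.of fun i j => rowVec B[i].2 B[j].1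
  have hA : A = Matrix.of T * pivotMinor L B := by
    ext i j
    simp only [A, Matrix.of_apply, Matrix.mul_apply, pivotMinor, ← hT i]
    simp
  have hup : A.IsUpperTriangular := fun i j hij =>
    List.pairwise_iff_getElem.1 h.pairwise j i j.2 i.2 hij
  have hdet : A.det ≠ 0 := by
    rw [Matrix.det_of_isUpperTriangular hup]
    exact Finset.prod_ne_zero_iff.2 fun i _ => (h.lead _ (List.getElem_mem i.2)).2.2.1
  rw [hA, Matrix.det_mul] at hdet
  exact right_ne_zero_of_mul hdet

/-- Cramer's rule for a row that vanishes on the pivot columns. -/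
lemma det_mul_eq {x v : ℕ → F} (hv : v - x ∈ spanLT L B.length) (h0 : ∀ a ∈ B, v a.1 = 0)
    (c : ℕ) : (pivotMinor L B).det * v c = (pivotMinor L B).det * x c
      - ∑ i, (pivotMinor L B).transpose.cramer (fun j => x B[j].1) i * L i c := by
  obtain ⟨a, ha⟩ := (Submodule.mem_span_range_iff_exists_fun F).1 hv
  -- With `v - x = ∑ a_i L_i` and `v` zero at the pivots, the vector `-a` solves the square system
  -- with right-hand side `x` on the pivot columns.
  have hb : (fun j : Fin B.length => x B[j].1) = (pivotMinor L B).transpose.mulVec (-a) := by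
    funext j
    have h1 := congrFun ha B[j].1
    simp only [Pi.sub_apply, Finset.sum_apply, Pi.smul_apply, smul_eq_mul] at h1
    have hj : v B[j].1 = 0 := h0 _ (List.getElem_mem j.2)
    rw [hj, zero_sub] at h1
    simp only [Matrix.mulVec, dotProduct, Matrix.transpose_apply, pivotMinor, Matrix.of_apply,
      Pi.neg_apply, mul_neg, Finset.sum_neg_distrib]
    rw [eq_comm, neg_eq_iff_eq_neg, ← h1]
    exact Finset.sum_congr rfl fun _ _ => mul_comm _ _
  have hcr : (pivotMinor L B).transpose.cramer (fun j => x B[j].1)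
      = (pivotMinor L B).det • (-a) := by
    rw [hb, Matrix.cramer_eq_adjugate_mulVec, Matrix.mulVec_mulVec, Matrix.adjugate_mul,
      Matrix.det_transpose, Matrix.smul_mulVec, Matrix.one_mulVec]
  have h2 : v c = x c + ∑ i, a i * L i c := by
    have := congrFun ha c
    simp only [Finset.sum_apply, Pi.smul_apply, smul_eq_mul, Pi.sub_apply] at this
    rw [this]; ring
  rw [hcr, h2, mul_add, Finset.mul_sum, sub_eq_add_neg, ← Finset.sum_neg_distrib]
  congr 1
  refine Finset.sum_congr rfl fun i _ => ?_
  simp only [Pi.smul_apply, Pi.neg_apply, smul_eq_mul]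
  ring

/-- A vector of the span that vanishes on the pivot columns is zero. -/
lemma eq_zero (h : Echelon n L B) {v : ℕ → F} (hv : v ∈ spanLT L B.length)
    (h0 : ∀ a ∈ B, v a.1 = 0) : v = 0 := by
  funext c
  have := det_mul_eq (x := 0) (by simpa using hv) h0 c
  have hz : (fun j : Fin B.length => (0 : ℕ → F) B[j].1) = 0 := rfl
  rw [hz, map_zero] at this
  simpa [h.det_ne_zero] using this

lemma of_append {B' : List (ℕ × List F)} (h : Echelon n L (B ++ B')) : Echelon n L B where
  pairwise := (List.pairwise_append.1 h.pairwise).1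
  lead a ha := h.lead a (List.mem_append_left _ ha)
  span i hi := by
    have := h.span i (by rw [List.length_append]; omega)
    rwa [List.getElem_append_left hi] at this

lemma concat (h : Echelon n L B) {p : ℕ} {b : List F} (hp : p < n) (hb : b.length = n)
    (hbp : b.getD p 0 ≠ 0) (hlt : ∀ c < p, b.getD c 0 = 0) (h0 : ∀ a ∈ B, b.getD a.1 0 = 0)
    (hspan : rowVec b - L B.length ∈ spanLT L B.length) : Echelon n L (B ++ [(p, b)]) where
  pairwise := List.pairwise_append.2 ⟨h.pairwise, List.pairwise_singleton _ _, fun a ha b' hb' => by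
    rw [List.mem_singleton.1 hb']; exact h0 a ha⟩
  lead a ha := by
    rcases List.mem_append.1 ha with ha | ha
    · exact h.lead a ha
    · rw [List.mem_singleton.1 ha]; exact ⟨hp, hb, hbp, hlt⟩
  span i hi := by
    rcases Nat.lt_or_ge i B.length with hi' | hi'
    · rw [List.getElem_append_left hi']; exact h.span i hi'
    · obtain rfl : i = B.length := by simp at hi; omega
      simpa using hspan

/-- Pivots are distinct: a row is nonzero at its own pivot and zero at those of the earlier rows.
This is the reason for termination. -/
lemma length_le (h : Echelon n L B) : B.length ≤ n := by
  have hnd : (B.map Prod.fst).Nodup := by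
    rw [List.Nodup, List.pairwise_map]
    refine h.pairwise.imp_of_mem fun ha hb hab heq => ?_
    rw [heq] at hab
    exact (h.lead _ hb).2.2.1 hab
  have hsub : (B.map Prod.fst).toFinset ⊆ Finset.range n := fun p hp => by
    obtain ⟨a, ha, rfl⟩ := List.mem_map.1 (List.mem_toFinset.1 hp)
    exact Finset.mem_range.2 (h.lead a ha).1
  have := Finset.card_le_card hsub
  rwa [List.toFinset_card_of_nodup hnd, List.length_map, Finset.card_range] at this

end Echelon

end Echelon

/-! ### Degrees of the entries during elimination. -/

namespace Echelon

open RatFun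

variable {K : Type*} [Field K] {n : ℕ} {L : ℕ → ℕ → RatFun K} {B : List (ℕ × List (RatFun K))}
  {S : MvPolynomial (Fin 2) K} {d M : ℕ}

/-- The entries of a row in the course of the elimination are quotients of minors. -/
lemma deg_le_of_reduced (h : Echelon n L B) (hS : S ≠ 0) (hd : S.totalDegree ≤ d)
    {x v : ℕ → RatFun K} (hL : ∀ i < B.length, ∀ c, PowerFraction S d M (L i c))
    (hx : ∀ c, PowerFraction S d M (x c)) (hv : v - x ∈ spanLT L B.length)
    (h0 : ∀ a ∈ B, v a.1 = 0) (c : ℕ) : (v c).deg ≤ 2 * ((B.length + 1) * M * d) := by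
  have h1 := det_mul_eq hv h0 c
  have hdet : PowerFraction S d (B.length * M) (pivotMinor L B).det :=
    PowerFraction.det fun i j => hL i i.2 _
  have hcr : ∀ i, PowerFraction S d (B.length * M)
      ((pivotMinor L B).transpose.cramer (fun j => x B[j].1) i) := fun i => by
    rw [Matrix.cramer_apply]
    refine PowerFraction.det fun a b => ?_
    rw [Matrix.updateCol_apply]
    split_ifs
    · exact hx _
    · exact hL b b.2 _
  have hnum : PowerFraction S d ((B.length + 1) * M) ((pivotMinor L B).det * x c
      - ∑ i, (pivotMinor L B).transpose.cramer (fun j => x B[j].1) i * L i c) := by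
    rw [add_mul, one_mul]
    exact (hdet.mul (hx c)).sub (PowerFraction.sum fun i _ => (hcr i).mul (hL i i.2 c))
  rw [← h1] at hnum
  -- Numerator and determinant are both over powers of `S`; the factor `2` in the bound comes from
  -- adding their degrees.
  have h2 : v c = ((pivotMinor L B).det * v c) / (pivotMinor L B).det := by
    field_simp [h.det_ne_zero]
  rw [h2, two_mul]
  refine (deg_div_le _ _).trans (add_le_add (hnum.deg_le hS hd) ((hdet.deg_le hS hd).trans ?_))
  exact Nat.mul_le_mul_right _ (Nat.mul_le_mul_right _ (Nat.le_succ _))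

/-- The row stored at place `i` is `L i` reduced by the `i` rows before it, so the bound for reduced
vectors applies to that prefix. -/
lemma deg_le (h : Echelon n L B) (hS : S ≠ 0) (hd : S.totalDegree ≤ d)
    (hL : ∀ i < B.length, ∀ c, PowerFraction S d M (L i c)) {b : ℕ × List (RatFun K)}
    (hb : b ∈ B) (c : ℕ) : (b.2.getD c 0).deg ≤ 2 * (B.length * M * d) := by
  obtain ⟨i, hi, rfl⟩ := List.getElem_of_mem hb
  have hlen : (B.take i).length = i := by rw [List.length_take]; omega
  have h1 : Echelon n L (B.take i) := of_append (B' := B.drop i) (by rwa [List.take_append_drop])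
  have h2 := h1.deg_le_of_reduced hS hd (x := L i) (v := rowVec B[i].2)
    (fun j hj => hL j (by omega)) (hL i hi) (by rw [hlen]; exact h.span i hi)
    (fun a ha => by
      obtain ⟨j, hj, rfl⟩ := List.getElem_of_mem ha
      rw [List.getElem_take]
      exact List.pairwise_iff_getElem.1 h.pairwise j i (by omega) hi (by omega)) c
  rw [hlen] at h2
  exact h2.trans (Nat.mul_le_mul_left _ (Nat.mul_le_mul_right _ (Nat.mul_le_mul_right _ hi)))

end Echelon

/-! ### Values computed by the algorithm -/

namespace Counted

universe u

variable {α β : Type u}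

@[simp] lemma pure_val (a : α) : (pure a : Counted α).val = a := rfl

@[simp] lemma bind_val (m : Counted α) (f : α → Counted β) : (m >>= f).val = (f m.val).val := rfl

end Counted

namespace ReduceTelescoper

open RatFun ElementaryOp

variable {K : Type*} [Field K]

lemma mapAll_val {α β : Type*} (f : α → Counted β) (l : List α) :
    (mapAll f l).val = l.map fun a => (f a).val := by
  induction l with
  | nil => rfl
  | cons a l ih => rw [mapAll, ih]; rfl

lemma dot_val (ps cs : List (RatFun K)) (acc : RatFun K) (h : ps.length = cs.length) :
    (dot ps cs acc).val = acc + ∑ i ∈ Finset.range ps.length, ps.getD i 0 * cs.getD i 0 := by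
  induction ps generalizing cs acc with
  | nil => cases cs <;> simp [dot]
  | cons p ps ih =>
    obtain _ | ⟨c, cs⟩ := cs
    · simp at h
    · rw [dot, Counted.bind_val, Counted.bind_val, ih _ _ (by simpa using h), List.length_cons,
        Finset.sum_range_succ']
      simp only [List.getD_cons_succ, List.getD_cons_zero, mul, add]
      ring

lemma powersDh_getD (v G : RatFun K) (n m i : ℕ) (hi : i ≤ n) :
    (powersDh v n m (iterDh v G m)).val.getD i 0 = iterDh v G (m + i) := by
  induction n generalizing m i with
  | zero => obtain rfl : i = 0 := by omega
            rfl
  | succ n ih =>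
    rcases i with _ | i
    · rfl
    · have h1 : (powersDh v (n + 1) m (iterDh v G m)).val.getD (i + 1) 0
          = (powersDh v n (m + 1) (iterDh v G (m + 1))).val.getD i 0 := rfl
      rw [h1, ih _ _ (by omega)]
      congr 1; omega

lemma integrandTerms_length (R : RatFun K) (k e : ℕ) (gs : List (RatFun K)) (n j : ℕ)
    (w : RatFun K) : (integrandTerms R k e gs n j w).val.length = n := by
  induction n generalizing j w with
  | zero => rfl
  | succ n ih => exact congrArg (· + 1) (ih (j + 1) _)

lemma integrandTerms_getD (R : RatFun K) (k e : ℕ) (gs : List (RatFun K)) (n j i : ℕ)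
    (hi : i < n) : (integrandTerms R k e gs n j (R ^ j)⁻¹).val.getD i 0
      = (R ^ (j + i))⁻¹ * gs.getD (k * (j + i) + e) 0 := by
  induction n generalizing j i with
  | zero => omega
  | succ n ih =>
    rcases i with _ | i
    · rfl
    · have h1 : (integrandTerms R k e gs (n + 1) j (R ^ j)⁻¹).val.getD (i + 1) 0
          = (integrandTerms R k e gs n (j + 1) ((R ^ j)⁻¹ / R)).val.getD i 0 := rfl
      have h2 : (R ^ j)⁻¹ / R = (R ^ (j + 1))⁻¹ := by
        rw [pow_succ, mul_inv, div_eq_mul_inv]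
      rw [h1, h2, ih _ _ (by omega), show j + 1 + i = j + (i + 1) by omega]

/-- `τ_c = U^{l mod k} D_h^{k(m-c) + (l mod k)} G`, `m = ⌊l/k⌋`. -/
noncomputable def integrandTerm (inp : ReduceInput K) (c : ℕ) : RatFun K :=
  (inp.R ^ (inp.l / inp.k - c))⁻¹ *
    iterDh (partialD 1 inp.R / ((inp.k : RatFun K) * inp.R)) inp.G
      (inp.k * (inp.l / inp.k - c) + inp.l % inp.k)

/-- The indices used never exceed `l`, so lookups in `[g_0, …, g_l]` never fall back on the default
value. -/
lemma order_le (inp : ReduceInput K) (c : ℕ) :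
    inp.k * (inp.l / inp.k - c) + inp.l % inp.k ≤ inp.l := by
  have h1 := Nat.div_add_mod inp.l inp.k
  have h2 : inp.k * (inp.l / inp.k - c) ≤ inp.k * (inp.l / inp.k) :=
    Nat.mul_le_mul_left _ (Nat.sub_le _ _)
  omega

lemma prepare_fst (inp : ReduceInput K) :
    (prepare inp).val.1 = totalDx inp.F inp.R / ((inp.k : RatFun K) * inp.R) := rfl

lemma prepare_snd (inp : ReduceInput K) : (prepare inp).val.2 =
    (integrandTerms inp.R inp.k (inp.l % inp.k)
      (powersDh (partialD 1 inp.R / ((inp.k : RatFun K) * inp.R)) inp.l 0 inp.G).val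
      (inp.l / inp.k + 1) 0 1).val.reverse := rfl

lemma prepare_snd_length (inp : ReduceInput K) :
    (prepare inp).val.2.length = inp.l / inp.k + 1 := by
  rw [prepare_snd, List.length_reverse, integrandTerms_length]

lemma prepare_snd_getD (inp : ReduceInput K) {c : ℕ} (hc : c < inp.l / inp.k + 1) :
    (prepare inp).val.2.getD c 0 = integrandTerm inp c := by
  have h1 : (1 : RatFun K) = (inp.R ^ 0)⁻¹ := by simp
  have h2 : inp.G = iterDh (partialD 1 inp.R / ((inp.k : RatFun K) * inp.R)) inp.G 0 := rfl
  rw [prepare_snd, List.getD_reverse _ (by rwa [integrandTerms_length]), integrandTerms_length, h1,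
    integrandTerms_getD _ _ _ _ _ _ _ (by omega), h2,
    powersDh_getD _ _ _ _ _ (by
      have := order_le inp c
      convert this using 3; omega)]
  simp only [integrandTerm, zero_add, Nat.add_sub_cancel]

/-- The row as a list. -/
def _root_.RelRow.toList (L : RelRow K) : List (RatFun K) := L.coeffs ++ [L.rhs]

lemma rowVec_toList_of_lt (L : RelRow K) {c : ℕ} (hc : c < L.coeffs.length) :
    rowVec L.toList c = L.coeffs.getD c 0 := by
  rw [rowVec, RelRow.toList, List.getD_append _ _ _ _ hc]

lemma rowVec_toList_length (L : RelRow K) : rowVec L.toList L.coeffs.length = L.rhs := by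
  rw [rowVec, RelRow.toList, List.getD_append_right _ _ _ _ le_rfl]
  simp

lemma rowVec_eq_zero (l : List (RatFun K)) {c : ℕ} (hc : l.length ≤ c) : rowVec l c = 0 :=
  List.getD_eq_default _ _ hc

lemma nextRow_length (inp : ReduceInput K) (u : RatFun K) (ts : List (RatFun K)) (L : RelRow K) :
    (nextRow inp u ts L).val.coeffs.length = L.coeffs.length := by
  have : (nextRow inp u ts L).val.coeffs = (mapAll (applyDx inp.F) L.coeffs).val := rfl
  rw [this, mapAll_val, List.length_map]

lemma rowVec_nextRow (inp : ReduceInput K) (u : RatFun K) (ts : List (RatFun K)) (L : RelRow K)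
    {m : ℕ} (hL : L.coeffs.length = m + 1) (hts : ts.length = m + 1) :
    rowVec (nextRow inp u ts L).val.toList
      = rowDeriv inp.F u m (inp.l % inp.k) (fun c => ts.getD c 0) (rowVec L.toList) := by
  have hlen := nextRow_length inp u ts L
  rw [hL] at hlen
  have hco : (nextRow inp u ts L).val.coeffs = L.coeffs.map (totalDx inp.F) :=
    mapAll_val (applyDx inp.F) L.coeffs
  have hrhs : (nextRow inp u ts L).val.rhs = totalDx inp.F L.rhs
    - ((inp.l % inp.k : ℕ) : RatFun K) * L.rhs * u - (dot L.coeffs ts 0).val := rfl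
  funext c
  rcases lt_trichotomy c (m + 1) with hc | rfl | hc
  · rw [rowVec_toList_of_lt _ (by omega), hco, rowDeriv, if_neg (by omega),
      rowVec_toList_of_lt _ (by omega), List.getD_eq_getElem _ _ (by simp; omega),
      List.getD_eq_getElem _ _ (by omega), List.getElem_map]
  · have h1 := rowVec_toList_length (nextRow inp u ts L).val
    have h2 := rowVec_toList_length L
    rw [hlen] at h1
    rw [hL] at h2
    rw [h1, hrhs, dot_val _ _ _ (by omega), rowDeriv, if_pos rfl, h2, zero_add, hL]
    congr 1
    refine Finset.sum_congr rfl fun i hi => ?_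
    rw [rowVec_toList_of_lt _ (by have := Finset.mem_range.1 hi; omega)]
  · rw [rowVec_eq_zero _ (by simp [RelRow.toList]; omega), rowDeriv, if_neg (by omega),
      rowVec_eq_zero _ (by simp [RelRow.toList]; omega), totalDx_zero]

/-- The rows `L_1, L_2, …` of the algorithm (numbered from `0`). -/
noncomputable def rows (inp : ReduceInput K) : ℕ → RelRow K
  | 0 => firstRow inp
  | i + 1 => (nextRow inp (prepare inp).val.1 (prepare inp).val.2 (rows inp i)).val

/-- The rows of the algorithm as vectors. -/
noncomputable def rowSeq (inp : ReduceInput K) (i : ℕ) : ℕ → RatFun K := rowVec (rows inp i).toList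

lemma rows_length (inp : ReduceInput K) (i : ℕ) :
    (rows inp i).coeffs.length = inp.l / inp.k + 1 := by
  induction i with
  | zero => simp [rows, firstRow]
  | succ i ih => rw [rows, nextRow_length, ih]

lemma rows_toList_length (inp : ReduceInput K) (i : ℕ) :
    (rows inp i).toList.length = inp.l / inp.k + 2 := by
  rw [RelRow.toList, List.length_append, rows_length]; rfl

/-- The bridge from the list program to linear algebra: each new row is the derivative of the
preceding one as a relation. -/
lemma rowSeq_succ (inp : ReduceInput K) (i : ℕ) : rowSeq inp (i + 1) =
    rowDeriv inp.F (totalDx inp.F inp.R / ((inp.k : RatFun K) * inp.R)) (inp.l / inp.k)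
      (inp.l % inp.k) (integrandTerm inp) (rowSeq inp i) := by
  rw [rowSeq, rows, rowVec_nextRow _ _ _ _ (rows_length inp i) (prepare_snd_length inp),
    prepare_fst]
  funext c
  simp only [rowDeriv]
  rw [Finset.sum_congr rfl fun j hj => by rw [prepare_snd_getD inp (Finset.mem_range.1 hj)]]
  rfl

lemma rowSeq_zero_of_le (inp : ReduceInput K) {c : ℕ} (hc : c ≤ inp.l / inp.k) :
    rowSeq inp 0 c = ofPoly (inp.Q (inp.l / inp.k - c)) := by
  rw [rowSeq, rowVec_toList_of_lt _ (by rw [rows_length]; omega), rows, firstRow,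
    List.getD_reverse _ (by simp; omega), List.getD_eq_getElem _ _ (by simp),
    List.getElem_map, List.getElem_range]
  simp

lemma rowSeq_zero_last (inp : ReduceInput K) :
    rowSeq inp 0 (inp.l / inp.k + 1) = ofPoly inp.P := by
  have := rowVec_toList_length (rows inp 0)
  rw [rows_length] at this
  exact this

lemma rowSeq_of_gt (inp : ReduceInput K) (i : ℕ) {c : ℕ} (hc : inp.l / inp.k + 2 ≤ c) :
    rowSeq inp i c = 0 := rowVec_eq_zero _ (by rwa [rows_toList_length])

/-! ### Elimination -/

lemma subMul_length (f : RatFun K) (as bs : List (RatFun K)) (h : as.length = bs.length) :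
    (subMul f as bs).val.length = as.length := by
  induction as generalizing bs with
  | nil => rfl
  | cons a as ih =>
    obtain _ | ⟨b, bs⟩ := bs
    · simp at h
    · exact congrArg (· + 1) (ih bs (by simpa using h))

lemma subMul_getD (f : RatFun K) (as bs : List (RatFun K)) (h : as.length = bs.length) (c : ℕ) :
    (subMul f as bs).val.getD c 0 = as.getD c 0 - f * bs.getD c 0 := by
  induction as generalizing bs c with
  | nil =>
    obtain rfl : bs = [] := List.eq_nil_of_length_eq_zero (by simpa using h.symm)
    simp [subMul]
  | cons a as ih =>
    obtain _ | ⟨b, bs⟩ := bs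
    · simp at h
    · rcases c with _ | c
      · rfl
      · exact ih bs (by simpa using h) c

/-- The state of the elimination of the vector `x` by the rows `B`. -/
structure Reduced (n : ℕ) (L : ℕ → ℕ → RatFun K) (x : ℕ → RatFun K)
    (B : List (ℕ × List (RatFun K))) (row : List (RatFun K)) : Prop where
  length : row.length = n
  sub_mem : rowVec row - x ∈ spanLT L B.length
  zero : ∀ a ∈ B, row.getD a.1 0 = 0

/-- The multiple is chosen to cancel the entry at the pivot of `b`. Zeros already made survive
because `b` itself vanishes at the earlier pivots. -/
lemma Reduced.step {n : ℕ} {L : ℕ → ℕ → RatFun K} {x : ℕ → RatFun K}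
    {B B' : List (ℕ × List (RatFun K))} {b : ℕ × List (RatFun K)} {row : List (RatFun K)}
    (hB : Echelon n L (B ++ b :: B')) (h : Reduced n L x B row) :
    Reduced n L x (B ++ [b]) (subMul (row.getD b.1 0 / b.2.getD b.1 0) row b.2).val := by
  have hb : b ∈ B ++ b :: B' := by simp
  obtain ⟨-, hblen, hb0, -⟩ := hB.lead b hb
  have hlen : row.length = b.2.length := by rw [h.length, hblen]
  refine ⟨by rw [subMul_length _ _ _ hlen, h.length], ?_, fun a ha => ?_⟩
  · have h1 : rowVec (subMul (row.getD b.1 0 / b.2.getD b.1 0) row b.2).val - x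
        = (rowVec row - x) - (row.getD b.1 0 / b.2.getD b.1 0) • rowVec b.2 := by
      funext c
      simp only [rowVec, Pi.sub_apply, Pi.smul_apply, smul_eq_mul, subMul_getD _ _ _ hlen]
      ring
    rw [h1, List.length_append]
    refine Submodule.sub_mem _ (spanLT_mono L (Nat.le_add_right _ _) h.sub_mem)
      (Submodule.smul_mem _ _ ?_)
    have h2 := hB.mem_span (i := B.length) (by simp)
    simpa using h2
  · rw [subMul_getD _ _ _ hlen]
    rcases List.mem_append.1 ha with ha | ha
    · have h3 := (List.pairwise_append.1 hB.pairwise).2.2 a ha b (by simp)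
      rw [h.zero a ha, h3, mul_zero, sub_zero]
    · rw [List.mem_singleton.1 ha, div_mul_cancel₀ _ hb0, sub_self]

lemma Reduced.eliminate {n : ℕ} {L : ℕ → ℕ → RatFun K} {x : ℕ → RatFun K}
    {B B' : List (ℕ × List (RatFun K))} {row : List (RatFun K)}
    (hB : Echelon n L (B ++ B')) (h : Reduced n L x B row) :
    Reduced n L x (B ++ B') (eliminate B' row).val := by
  induction B' generalizing B row with
  | nil => simpa [ReduceTelescoper.eliminate] using h
  | cons b B' ih =>
    have h1 := ih (B := B ++ [b]) (by simpa using hB) (h.step hB)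
    rwa [List.append_assoc, List.singleton_append] at h1

lemma pivot_none (j : ℕ) (row : List (RatFun K)) (h : (pivot j row).val = none) (c : ℕ) :
    row.getD c 0 = 0 := by
  induction row generalizing j c with
  | nil => rfl
  | cons a as ih =>
    by_cases ha : a = 0
    · rcases c with _ | c
      · exact ha
      · refine ih (j + 1) ?_ c
        simpa [pivot, isZero, ha] using h
    · simp [pivot, isZero, ha] at h

lemma pivot_some (j : ℕ) (row : List (RatFun K)) {p : ℕ} (h : (pivot j row).val = some p) :
    ∃ i, p = j + i ∧ i < row.length ∧ row.getD i 0 ≠ 0 ∧ ∀ c < i, row.getD c 0 = 0 := by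
  induction row generalizing j with
  | nil => simp [pivot] at h
  | cons a as ih =>
    by_cases ha : a = 0
    · obtain ⟨i, rfl, hi, h1, h2⟩ := ih (j + 1) (by simpa [pivot, isZero, ha] using h)
      refine ⟨i + 1, by omega, by simpa using hi, by simpa using h1, fun c hc => ?_⟩
      rcases c with _ | c
      · exact ha
      · simpa using h2 c (by omega)
    · refine ⟨0, ?_, by simp, by simpa using ha, by simp⟩
      simpa [pivot, isZero, ha, eq_comm] using h

/-! ### The loop -/

/-- The invariant of the loop. -/
structure LoopInv (inp : ReduceInput K) (st : LoopState K) : Prop where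
  current : st.current = rows inp st.basis.length
  echelon : Echelon (inp.l / inp.k + 2) (rowSeq inp) st.basis

lemma LoopInv.initial (inp : ReduceInput K) : LoopInv inp ⟨firstRow inp, []⟩ := ⟨rfl, Echelon.nil⟩

lemma LoopInv.reduced {inp : ReduceInput K} {st : LoopState K} (h : LoopInv inp st) :
    Reduced (inp.l / inp.k + 2) (rowSeq inp) (rowSeq inp st.basis.length) st.basis
      (eliminate st.basis (st.current.coeffs ++ [st.current.rhs])).val := by
  refine Reduced.eliminate (B := []) h.echelon ⟨?_, ?_, by simp⟩
  · rw [h.current]; exact rows_toList_length inp _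
  · rw [h.current, rowSeq, RelRow.toList, sub_self]; exact zero_mem _

/-- If the reduced row is zero, the current row lies in the span of its predecessors; if not, its
first nonzero entry is a new pivot and the invariant extends. -/
lemma LoopInv.loopStep {inp : ReduceInput K} {st : LoopState K} (h : LoopInv inp st) :
    ((loopStep inp (prepare inp).val.1 (prepare inp).val.2 st).val = Sum.inl st.basis ∧
      rowSeq inp st.basis.length ∈ spanLT (rowSeq inp) st.basis.length) ∨
    ∃ st', (ReduceTelescoper.loopStep inp (prepare inp).val.1 (prepare inp).val.2 st).val
      = Sum.inr st' ∧ LoopInv inp st' ∧ st'.basis.length = st.basis.length + 1 := by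
  have hred := h.reduced
  set row := eliminate st.basis (st.current.coeffs ++ [st.current.rhs]) with hrow
  rcases hp : (pivot 0 row.val).val with _ | p
  · left
    refine ⟨?_, ?_⟩
    · simp only [ReduceTelescoper.loopStep, ← hrow]
      rw [hp]
    · have h1 : rowVec row.val = 0 := funext fun c => pivot_none 0 _ hp c
      simpa [h1] using hred.sub_mem
  · right
    obtain ⟨i, hi, hlt, hne, hz⟩ := pivot_some 0 _ hp
    obtain rfl : p = i := by omega
    refine ⟨⟨(nextRow inp (prepare inp).val.1 (prepare inp).val.2 st.current).val,
      st.basis ++ [(p, row.val)]⟩, ?_, ⟨?_, ?_⟩, by simp⟩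
    · simp only [ReduceTelescoper.loopStep, ← hrow]
      rw [hp]
    · rw [h.current, List.length_append]; rfl
    · exact h.echelon.concat (hred.length ▸ hlt) hred.length hne hz hred.zero hred.sub_mem

/-- What is known about the echelon form with which the loop is left. -/
lemma LoopRuns.echelon {inp : ReduceInput K} {st : LoopState K}
    {B : List (ℕ × List (RatFun K))} {ops : List ℕ}
    (hr : LoopRuns inp (prepare inp).val.1 (prepare inp).val.2 st B ops) (h : LoopInv inp st) :
    Echelon (inp.l / inp.k + 2) (rowSeq inp) B ∧
      rowSeq inp B.length ∈ spanLT (rowSeq inp) B.length := by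
  induction hr with
  | halt st B h1 =>
    rcases h.loopStep with ⟨h2, h3⟩ | ⟨st', h2, -⟩
    · obtain rfl : st.basis = B := Sum.inl.inj (h2.symm.trans h1)
      exact ⟨h.echelon, h3⟩
    · exact absurd (h2.symm.trans h1) (by simp)
  | next st st' B ops h1 _ ih =>
    rcases h.loopStep with ⟨h2, -⟩ | ⟨st'', h2, h3, -⟩
    · exact absurd (h2.symm.trans h1) (by simp)
    · obtain rfl : st'' = st' := Sum.inr.inj (h2.symm.trans h1)
      exact ih h3

/-- Each continuing pass adds an echelon row, of which there are at most `m + 2`; the number of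
missing rows decreases. -/
lemma LoopInv.exists_loopRuns {inp : ReduceInput K} {st : LoopState K} (h : LoopInv inp st) :
    ∃ B ops, LoopRuns inp (prepare inp).val.1 (prepare inp).val.2 st B ops := by
  generalize hn : inp.l / inp.k + 2 - st.basis.length = n
  induction n using Nat.strong_induction_on generalizing st with
  | _ n ih =>
  rcases h.loopStep with ⟨h2, -⟩ | ⟨st', h2, h3, h4⟩
  · exact ⟨_, _, LoopRuns.halt st _ h2⟩
  · have := h3.echelon.length_le
    obtain ⟨B, ops, hB⟩ := ih _ (by omega) h3 rfl
    exact ⟨B, _, LoopRuns.next st st' B ops h2 hB⟩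

/-- The algorithm terminates. -/
lemma exists_runs (inp : ReduceInput K) : ∃ out ops, Runs inp out ops := by
  obtain ⟨B, ops, hB⟩ := (LoopInv.initial inp).exists_loopRuns
  exact ⟨_, _, B, ops, hB, rfl, rfl⟩

end ReduceTelescoper

/-! ### Correctness -/

namespace ReduceTelescoper

open RatFun ElementaryOp

variable {K : Type*} [Field K]

lemma const_injective : Function.Injective (const : K → RatFun K) := fun _ _ h =>
  C_injective _ _ (ofPoly_inj.1 h)

lemma const_one : const (1 : K) = 1 := by rw [const, map_one, ofPoly_one]

lemma const_zero : const (0 : K) = 0 := by rw [const, map_zero, ofPoly_zero]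

/-- The span of the rows is stable under the operation that produces new rows. -/
lemma rowDeriv_mem_spanLT (inp : ReduceInput K) {r : ℕ}
    (hr : rowSeq inp r ∈ spanLT (rowSeq inp) r) {v : ℕ → RatFun K}
    (hv : v ∈ spanLT (rowSeq inp) r) :
    rowDeriv inp.F (totalDx inp.F inp.R / ((inp.k : RatFun K) * inp.R)) (inp.l / inp.k)
      (inp.l % inp.k) (integrandTerm inp) v ∈ spanLT (rowSeq inp) r := by
  induction hv using Submodule.span_induction with
  | mem x hx =>
    obtain ⟨⟨i, hi⟩, rfl⟩ := hx
    dsimp only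
    rw [← rowSeq_succ]
    -- The derivative of a generator is the next generator, except for the last one, where the
    -- dependence `hr` takes over.
    rcases Nat.lt_or_ge (i + 1) r with h | h
    · exact mem_spanLT _ h
    · obtain rfl : r = i + 1 := by omega
      exact hr
  | zero =>
    convert (spanLT (rowSeq inp) r).zero_mem using 1
    funext c
    simp [rowDeriv]
  | add x y _ _ hx hy => rw [rowDeriv_add]; exact add_mem hx hy
  | smul f x hx' hx =>
    rw [rowDeriv_smul]
    exact add_mem (Submodule.smul_mem _ _ hx') (Submodule.smul_mem _ _ hx)

/-- After the first `p` columns are dropped, position `i` holds column `p + i`, which carries the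
coefficient of index `m - p - i`, `m = ⌊l/k⌋`; hence the reversed list. -/
lemma normalizeLast_val (inp : ReduceInput K) {B : List (ℕ × List (RatFun K))} {p : ℕ}
    {b : List (RatFun K)} (hB : B.argmax Prod.fst = some (p, b)) (hp : p ≤ inp.l / inp.k)
    (hb : b.length = inp.l / inp.k + 2) {a : ℕ → K} {H : RatFun K}
    (ha : ∀ i ≤ inp.l / inp.k - p, b.getD (inp.l / inp.k - i) 0 / b.getD p 0 = const (a i))
    (hH : b.getD (inp.l / inp.k + 1) 0 / b.getD p 0 = H) :
    (normalizeLast inp B).val = some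
      ⟨((List.range (inp.l / inp.k - p + 1)).map fun i => const (a i)).reverse, H⟩ := by
  have h1 : (normalizeLast inp B).val
      = some ⟨(mapAll (fun a => div a (b.getD p 0)) (b.drop p)).val.dropLast,
        (mapAll (fun a => div a (b.getD p 0)) (b.drop p)).val.getLastD 0⟩ := by
    rw [normalizeLast, hB]
    simp only [if_pos hp]
    rfl
  have h2 : (mapAll (fun a => div a (b.getD p 0)) (b.drop p)).val
      = (b.drop p).map (· / b.getD p 0) := mapAll_val _ _
  rw [h1, h2]
  have hlen : ((b.drop p).map (· / b.getD p 0)).length = inp.l / inp.k - p + 2 := by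
    rw [List.length_map, List.length_drop, hb]; omega
  congr 2
  · refine List.ext_getElem ?_ fun i hi hi' => ?_
    · rw [List.length_dropLast, hlen]; simp
    · rw [List.length_dropLast, hlen] at hi
      rw [List.getElem_dropLast, List.getElem_map, List.getElem_drop, List.getElem_reverse,
        List.getElem_map, List.getElem_range]
      simp only [List.length_map, List.length_range]
      rw [← ha _ (by omega), ← List.getD_eq_getElem b 0]
      congr 2
      omega
  · have hne : (b.drop p).map (· / b.getD p 0) ≠ [] := by
      rw [← List.length_pos_iff, hlen]; omega
    rw [List.getLastD_eq_getLast?, List.getLast?_eq_some_getLast hne, Option.getD_some,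
      List.getLast_eq_getElem, List.getElem_map, List.getElem_drop, ← hH,
      ← List.getD_eq_getElem b 0]
    congr 2
    rw [hlen]
    omega

lemma rowSeq_zero_ne_zero {inp : ReduceInput K}
    (hnt : PseudoNontrivial inp.k inp.l inp.Q inp.P) : rowSeq inp 0 ≠ 0 := by
  intro h0
  rcases hnt with ⟨i, hi, hQ⟩ | hP
  · have := congrFun h0 (inp.l / inp.k - i)
    rw [rowSeq_zero_of_le _ (by omega), Nat.sub_sub_self hi] at this
    exact hQ (ofPoly_eq_zero.1 this)
  · have := congrFun h0 (inp.l / inp.k + 1)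
    rw [rowSeq_zero_last] at this
    exact hP (ofPoly_eq_zero.1 this)

variable [Algebra K ℂ]

lemma rowSeq_zero_mem {inp : ReduceInput K} {Φ : ℂ × ℂ → ℂ} {D : Set (ℂ × ℂ)} {y I : ℂ × ℂ → ℂ}
    (hpt : IsPseudoTelescoper inp.k inp.l Φ D y I inp.Q inp.P) :
    rowSeq inp 0 ∈ relations K inp.k (inp.l / inp.k) (inp.l % inp.k) Φ D y I := by
  refine ⟨1, one_ne_zero, fun w hw _ => ?_⟩
  rw [RelationAt, rowSeq_zero_last, (hasValue_ofPoly inp.P _).2, ← hpt w hw,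
    ← Finset.sum_range_reflect]
  refine Finset.sum_congr rfl fun c hc => ?_
  have hc' := Finset.mem_range.1 hc
  rw [rowSeq_zero_of_le _ (by omega), (hasValue_ofPoly _ _).2,
    show inp.l / inp.k - (inp.l / inp.k + 1 - 1 - c) = c by omega]

lemma spanLT_le_relations {inp : ReduceInput K} {Ω : Set (ℂ × ℂ)} {Φ : ℂ × ℂ → ℂ}
    {D : Set (ℂ × ℂ)} {y I : ℂ × ℂ → ℂ}
    (h : IsDarbouxianIntegral inp.F inp.G inp.R inp.k Ω Φ D y I)
    (hpt : IsPseudoTelescoper inp.k inp.l Φ D y I inp.Q inp.P) (r : ℕ) :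
    spanLT (rowSeq inp) r ≤ relations K inp.k (inp.l / inp.k) (inp.l % inp.k) Φ D y I := by
  have hrow : ∀ i, rowSeq inp i ∈ relations K inp.k (inp.l / inp.k) (inp.l % inp.k) Φ D y I := by
    intro i
    induction i with
    | zero => exact rowSeq_zero_mem hpt
    | succ i ih =>
      rw [rowSeq_succ]
      exact h.rowDeriv_mem (fun c _ => rfl) ih
  refine Submodule.span_le.2 ?_
  rintro _ ⟨i, rfl⟩
  exact hrow i

/-- On a nontrivial pseudo telescoper the algorithm returns a true telescoper. -/
lemma Runs.telescoper {inp : ReduceInput K} {out : Option (RelRow K)} {ops : List ℕ}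
    (hruns : Runs inp out ops) {Ω : Set (ℂ × ℂ)} {Φ : ℂ × ℂ → ℂ} {D : Set (ℂ × ℂ)}
    {y I : ℂ × ℂ → ℂ} (h : IsDarbouxianIntegral inp.F inp.G inp.R inp.k Ω Φ D y I)
    (hF : NoRationalFirstIntegral inp.F) (hnt : PseudoNontrivial inp.k inp.l inp.Q inp.P)
    (hpt : IsPseudoTelescoper inp.k inp.l Φ D y I inp.Q inp.P) :
    ∃ (s : ℕ) (a : ℕ → K) (H : RatFun K),
      out = some ⟨((List.range (s + 1)).map fun i => const (a i)).reverse, H⟩ ∧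
      IsTelescoper inp.k s (inp.l % inp.k) Φ D y I a H := by
  obtain ⟨B, loopOps, hloop, rfl, -⟩ := hruns
  obtain ⟨hE, hlast⟩ := hloop.echelon (LoopInv.initial inp)
  set m := inp.l / inp.k with hm
  -- An empty echelon form would put the first row in the zero space, contrary to nontriviality.
  have hB : B ≠ [] := by
    rintro rfl
    exact rowSeq_zero_ne_zero hnt (hE.eq_zero hlast (by simp))
  obtain ⟨⟨p, b⟩, hmax⟩ : ∃ a, B.argmax Prod.fst = some a :=
    Option.ne_none_iff_exists'.1 (mt List.argmax_eq_none.1 hB)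
  have hbB : (p, b) ∈ B := List.argmax_mem hmax
  have hle : ∀ a ∈ B, a.1 ≤ p := fun a ha => List.le_of_mem_argmax (f := Prod.fst) ha hmax
  obtain ⟨hpn, hblen, hb0, hblt⟩ := hE.lead _ hbB
  dsimp only at hpn hblen hb0 hblt
  set v : ℕ → RatFun K := (b.getD p 0)⁻¹ • rowVec b with hv
  have hvc : ∀ c, v c = b.getD c 0 / b.getD p 0 := fun c => by
    rw [hv, Pi.smul_apply, smul_eq_mul, rowVec, inv_mul_eq_div]
  have hvV : v ∈ spanLT (rowSeq inp) B.length := Submodule.smul_mem _ _ (hE.mem_span_of_mem hbB)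
  have hvrel := spanLT_le_relations h hpt _ hvV
  have hvp : v p = 1 := by rw [hvc, div_self hb0]
  have hvlt : ∀ c < p, v c = 0 := fun c hc => by rw [hvc, hblt c hc, zero_div]
  obtain ⟨w₀, hw₀⟩ := h.solution.nonempty
  -- A pivot in the right-hand column would give the relation `0 = U^{-e}`, regular everywhere and
  -- false at any point of the solution.
  have hpm : p ≤ m := by
    by_contra hlt
    obtain rfl : p = m + 1 := by omega
    have hreg : ∀ c < m + 2, RegularAt (v c) (w₀.1, y w₀) := fun c hc => by
      rcases Nat.lt_or_ge c (m + 1) with hc' | hc'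
      · rw [hvlt c hc']; exact (hasValue_zero _).1
      · obtain rfl : c = m + 1 := by omega
        rw [hvp]; exact (hasValue_one _).1
    have hrel := h.relationAt hvrel hw₀ hreg
    rw [RelationAt, hvp, (hasValue_one _).2, Finset.sum_eq_zero fun c hc => by
      rw [hvlt c (Finset.mem_range.1 hc), (hasValue_zero _).2, zero_mul]] at hrel
    rw [mul_one] at hrel
    exact inv_ne_zero (pow_ne_zero _ (h.factor_ne_zero hw₀)) hrel.symm
  -- The central step: the derivative of `v` stays in the span and vanishes at every pivot, because
  -- `p` is the largest pivot, `v` is zero before `p`, and `D_x 1 = 0`.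
  have hδ := hE.eq_zero (rowDeriv_mem_spanLT inp hlast hvV) fun a ha => by
    have hap := hle a ha
    rw [rowDeriv, if_neg (by omega)]
    rcases hap.lt_or_eq with h1 | h1
    · rw [hvlt _ h1, totalDx_zero]
    · rw [h1, hvp, totalDx_one]
  have hconst : ∀ c, ∃ α : K, c ≤ m → v c = const α := fun c => by
    by_cases hc : c ≤ m
    · have h1 := congrFun hδ c
      rw [rowDeriv, if_neg (by omega)] at h1
      obtain ⟨α, hα⟩ := hF.eq_const h1
      exact ⟨α, fun _ => hα⟩
    · exact ⟨0, fun h' => absurd h' hc⟩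
  choose α hα using hconst
  refine ⟨m - p, fun i => α (m - i), v (m + 1), ?_, Nat.mod_lt _ h.darbouxian.k_pos, ?_, ?_⟩
  · exact normalizeLast_val inp hmax hpm hblen
      (fun i hi => by rw [← hvc]; exact hα _ (by omega)) (hvc _).symm
  · have h1 := hα p hpm
    rw [hvp, ← const_one] at h1
    dsimp only
    rw [Nat.sub_sub_self hpm]
    exact (const_injective h1).symm
  · intro w hw hH
    have hreg : ∀ c < m + 2, RegularAt (v c) (w.1, y w) := fun c hc => by
      rcases Nat.lt_or_ge c (m + 1) with hc' | hc'
      · rw [hα c (by omega)]; exact (hasValue_const _ _).1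
      · obtain rfl : c = m + 1 := by omega
        exact hH
    rw [← h.relationAt hvrel hw hreg]
    conv_rhs => rw [← Finset.sum_range_reflect]
    -- The order sum runs to `m`, the telescoper only to `m - p`; the terms in between belong to
    -- columns left of the pivot and are zero.
    refine (Finset.sum_subset (Finset.range_mono (by omega)) fun i hi hi' => ?_).trans
      (Finset.sum_congr rfl fun i hi => ?_)
    · have h1 := Finset.mem_range.1 hi
      rw [Finset.mem_range] at hi'
      have h2 := hα (m - i) (by omega)
      rw [hvlt _ (by omega), ← const_zero] at h2
      dsimp only
      rw [← const_injective h2, map_zero, zero_mul]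
    · have h1 := Finset.mem_range.1 hi
      rw [hα _ (by omega), (hasValue_const _ _).2,
        show inp.l / inp.k + 1 - 1 - i = m - i by omega,
        show inp.l / inp.k - (m - i) = i by omega]

end ReduceTelescoper

/-! ### Running time -/

/-- There are at most `n` operations, on operands of degree at most `D`. -/
def OpsBound (ops : List ℕ) (n D : ℕ) : Prop := ops.length ≤ n ∧ ∀ d ∈ ops, d ≤ D

namespace OpsBound

universe u

variable {α β : Type u} {ops ops' : List ℕ} {n n' D D' a b : ℕ}

lemma mono (h : OpsBound ops n D) (hn : n ≤ n') (hD : D ≤ D') : OpsBound ops n' D' :=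
  ⟨h.1.trans hn, fun d hd => (h.2 d hd).trans hD⟩

lemma nil : OpsBound [] n D := ⟨Nat.zero_le _, by simp⟩

lemma append (h : OpsBound ops n D) (h' : OpsBound ops' n' D) :
    OpsBound (ops ++ ops') (n + n') D := by
  refine ⟨by rw [List.length_append]; exact add_le_add h.1 h'.1, fun d hd => ?_⟩
  rcases List.mem_append.1 hd with hd | hd
  · exact h.2 d hd
  · exact h'.2 d hd

lemma bind {m : Counted α} {f : α → Counted β} (h : OpsBound m.ops n D)
    (h' : OpsBound (f m.val).ops n' D) : OpsBound (m >>= f).ops (n + n') D := h.append h'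

lemma unary (h : a ≤ D) : OpsBound [a] 1 D := ⟨le_rfl, by simpa using h⟩

lemma binary (ha : a ≤ D) (hb : b ≤ D) : OpsBound [max a b] 1 D := unary (max_le ha hb)

lemma runTime_le (c : ℕ) (h : OpsBound ops n D) :
    runTime c ops ≤ n * ((D + 1) * Nat.log 2 (D + 2) ^ c) := by
  have h1 : ∀ x ∈ ops.map fun d => (d + 1) * Nat.log 2 (d + 2) ^ c,
      x ≤ (D + 1) * Nat.log 2 (D + 2) ^ c := by
    intro x hx
    obtain ⟨d, hd, rfl⟩ := List.mem_map.1 hx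
    have := h.2 d hd
    gcongr
  have h2 := List.sum_le_card_nsmul _ _ h1
  rw [List.length_map, smul_eq_mul] at h2
  exact h2.trans (Nat.mul_le_mul_right _ h.1)

end OpsBound

/-! ### A common denominator for the data and the rows. -/

namespace ReduceTelescoper

open RatFun ElementaryOp

variable {K : Type*} [Field K] {S : MvPolynomial (Fin 2) K} {d : ℕ}

lemma _root_.RatFun.PowerFraction.deg_le_of_le {f : RatFun K} {M M' : ℕ} (hS : S ≠ 0)
    (hd : S.totalDegree ≤ d) (hf : PowerFraction S d M f) (h : M ≤ M') : f.deg ≤ M' * d :=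
  (hf.deg_le hS hd).trans (Nat.mul_le_mul_right _ h)

lemma _root_.RatFun.PowerFraction.pow {f : RatFun K} (hf : PowerFraction S d 1 f) (n : ℕ) :
    PowerFraction S d n (f ^ n) := by
  induction n with
  | zero => simpa using PowerFraction.one
  | succ n ih => rw [pow_succ]; exact ih.mul hf

/-- The data of the input are fractions with denominator `S` and degree at most `d`. -/
structure HasDenominator (S : MvPolynomial (Fin 2) K) (d : ℕ) (inp : ReduceInput K) : Prop where
  ne_zero : S ≠ 0
  degree_le : S.totalDegree ≤ d
  F : PowerFraction S d 1 inp.F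
  G : PowerFraction S d 1 inp.G
  R : PowerFraction S d 1 inp.R
  R_inv : PowerFraction S d 1 inp.R⁻¹
  Q : ∀ i ≤ inp.l / inp.k, PowerFraction S d 1 (ofPoly (inp.Q i))
  P : PowerFraction S d 1 (ofPoly inp.P)

/-- `S = den F · den G · num R · den R`, of degree at most `4N`; the numerator of `R` is included so
that `R⁻¹` is covered. The fifth `N` makes room for the polynomials `Q_i`, `P` written over `S`. -/
lemma exists_hasDenominator {inp : ReduceInput K} {N : ℕ} (hR : inp.R ≠ 0)
    (h : inp.DegreeLE N) : ∃ S, HasDenominator S (5 * N) inp := by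
  obtain ⟨hF, hG, hR', hQ, hP⟩ := h
  have hRn : num inp.R ≠ 0 := mt num_eq_zero.1 hR
  have h1 := (totalDegree_num_le inp.F).trans hF
  have h2 := (totalDegree_den_le inp.F).trans hF
  have h3 := (totalDegree_num_le inp.G).trans hG
  have h4 := (totalDegree_den_le inp.G).trans hG
  have h5 := (totalDegree_num_le inp.R).trans hR'
  have h6 := (totalDegree_den_le inp.R).trans hR'
  have hmul : ∀ {p q : MvPolynomial (Fin 2) K} {a b : ℕ}, p.totalDegree ≤ a → q.totalDegree ≤ b →
      (p * q).totalDegree ≤ a + b := fun ha hb =>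
    (totalDegree_mul _ _).trans (add_le_add ha hb)
  have hS : den inp.F * den inp.G * (num inp.R * den inp.R) ≠ 0 :=
    mul_ne_zero (mul_ne_zero (den_ne_zero _) (den_ne_zero _)) (mul_ne_zero hRn (den_ne_zero _))
  have hdeg := hmul (hmul h2 h4) (hmul h5 h6)
  refine ⟨den inp.F * den inp.G * (num inp.R * den inp.R), hS, by omega, ?_, ?_, ?_, ?_, ?_, ?_⟩
  · have := hmul h4 (hmul h5 h6)
    exact PowerFraction.of_dvd hS (num_div_den _).symm (r := den inp.G * (num inp.R * den inp.R))
      (by ring) (by omega)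
  · have := hmul h2 (hmul h5 h6)
    exact PowerFraction.of_dvd hS (num_div_den _).symm (r := den inp.F * (num inp.R * den inp.R))
      (by ring) (by omega)
  · have := hmul (hmul h2 h4) h5
    exact PowerFraction.of_dvd hS (num_div_den _).symm (r := den inp.F * den inp.G * num inp.R)
      (by ring) (by omega)
  · have hr : inp.R⁻¹ = ofPoly (den inp.R) / ofPoly (num inp.R) := by
      rw [← inv_div, num_div_den]
    have := hmul (hmul h2 h4) h6
    exact PowerFraction.of_dvd hS hr (r := den inp.F * den inp.G * den inp.R) (by ring) (by omega)
  · intro i hi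
    have := hQ i hi
    exact PowerFraction.ofPoly hS (by omega)
  · exact PowerFraction.ofPoly hS (by omega)

lemma powerFraction_totalDx {F f : RatFun K} {M : ℕ} (hS : S ≠ 0) (hd : S.totalDegree ≤ d)
    (hF : PowerFraction S d 1 F) (hf : PowerFraction S d M f) :
    PowerFraction S d (M + 2) (totalDx F f) :=
  ((hf.partialD hS hd 0).mono hS hd (by omega)).add
    ((hF.mul (hf.partialD hS hd 1)).mono hS hd (by omega))

lemma HasDenominator.log {inp : ReduceInput K} (h : HasDenominator S d inp) {f : RatFun K} {M : ℕ}
    (hf : PowerFraction S d M f) :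
    PowerFraction S d (M + 1) (f / ((inp.k : RatFun K) * inp.R)) := by
  rw [div_eq_mul_inv, mul_inv]
  exact hf.mul (((PowerFraction.natCast_inv _).mul h.R_inv).mono h.ne_zero h.degree_le le_rfl)

/-- Each step multiplies by `v = ∂_y R / (kR)`, of exponent `3`: two for `∂_y R`, one for `R⁻¹`. -/
lemma HasDenominator.iterDh {inp : ReduceInput K} (h : HasDenominator S d inp) (n : ℕ) :
    PowerFraction S d (3 * n + 1)
      (iterDh (partialD 1 inp.R / ((inp.k : RatFun K) * inp.R)) inp.G n) := by
  induction n with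
  | zero => exact h.G
  | succ n ih =>
    rw [_root_.iterDh]
    have hv := h.log (h.R.partialD h.ne_zero h.degree_le 1)
    refine ((ih.partialD h.ne_zero h.degree_le 1).mono h.ne_zero h.degree_le (by omega)).sub ?_
    exact (((PowerFraction.natCast n).mul hv).mul ih).mono h.ne_zero h.degree_le (by omega)

lemma HasDenominator.integrandTerm {inp : ReduceInput K} (h : HasDenominator S d inp) (c : ℕ) :
    PowerFraction S d (4 * inp.l + 1) (integrandTerm inp c) := by
  rw [ReduceTelescoper.integrandTerm, ← inv_pow]
  refine ((h.R_inv.pow _).mul (h.iterDh _)).mono h.ne_zero h.degree_le ?_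
  have h1 := order_le inp c
  have h2 : inp.l / inp.k - c ≤ inp.l := (Nat.sub_le _ _).trans (Nat.div_le_self _ _)
  omega

/-- `D_x` costs exponent `2`, one for the derivative and one for `F`. On the right-hand side the
product with `u = D_x R / (kR)` costs `4`, and the integrand terms bring in the summand `4l`. -/
lemma HasDenominator.rowSeq {inp : ReduceInput K} (h : HasDenominator S d inp) (i : ℕ) :
    (∀ c ≤ inp.l / inp.k, PowerFraction S d (2 * i + 1) (rowSeq inp i c)) ∧
      PowerFraction S d (4 * inp.l + 4 * i + 2) (rowSeq inp i (inp.l / inp.k + 1)) := by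
  induction i with
  | zero =>
    refine ⟨fun c hc => ?_, ?_⟩
    · rw [rowSeq_zero_of_le _ hc]
      exact h.Q _ (by omega)
    · rw [rowSeq_zero_last]
      exact h.P.mono h.ne_zero h.degree_le (by omega)
  | succ i ih =>
    obtain ⟨ih1, ih2⟩ := ih
    rw [rowSeq_succ]
    refine ⟨fun c hc => ?_, ?_⟩
    · rw [rowDeriv, if_neg (by omega)]
      exact (powerFraction_totalDx h.ne_zero h.degree_le h.F (ih1 c hc)).mono h.ne_zero h.degree_le
        (by omega)
    · rw [rowDeriv, if_pos rfl]
      have hu := h.log (powerFraction_totalDx h.ne_zero h.degree_le h.F h.R)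
      refine PowerFraction.sub (PowerFraction.sub ?_ ?_) (PowerFraction.sum fun j hj => ?_)
      · exact (powerFraction_totalDx h.ne_zero h.degree_le h.F ih2).mono h.ne_zero h.degree_le
          (by omega)
      · exact (((PowerFraction.natCast _).mul ih2).mul hu).mono h.ne_zero h.degree_le (by omega)
      · have := Finset.mem_range.1 hj
        exact ((ih1 j (by omega)).mul (h.integrandTerm j)).mono h.ne_zero h.degree_le (by omega)

lemma HasDenominator.rowSeq_of_le {inp : ReduceInput K} (h : HasDenominator S d inp) {i : ℕ}
    (hi : i ≤ inp.l + 2) (c : ℕ) :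
    PowerFraction S d (8 * inp.l + 10) (ReduceTelescoper.rowSeq inp i c) := by
  obtain ⟨h1, h2⟩ := h.rowSeq i
  rcases lt_trichotomy c (inp.l / inp.k + 1) with hc | rfl | hc
  · exact (h1 c (by omega)).mono h.ne_zero h.degree_le (by omega)
  · exact h2.mono h.ne_zero h.degree_le (by omega)
  · rw [rowSeq_of_gt _ _ (by omega)]
    exact PowerFraction.zero

/-! ### Number and size of the operations -/

lemma applyDx_ops {F f : RatFun K} {M D : ℕ} (hS : S ≠ 0) (hd : S.totalDegree ≤ d)
    (hF : PowerFraction S d 1 F) (hf : PowerFraction S d M f) (hD : (M + 2) * d ≤ D) :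
    OpsBound (applyDx F f).ops 4 D := by
  have h0 := hf.partialD hS hd 0
  have h1 := hf.partialD hS hd 1
  have : OpsBound (applyDx F f).ops (1 + (1 + (1 + 1))) ((M + 2) * d) :=
    .bind (.unary (hf.deg_le_of_le hS hd (by omega)))
      (.bind (.unary (hf.deg_le_of_le hS hd (by omega)))
      (.bind (.binary (hF.deg_le_of_le hS hd (by omega)) (h1.deg_le_of_le hS hd (by omega)))
      (.binary (h0.deg_le_of_le hS hd (by omega)) ((hF.mul h1).deg_le_of_le hS hd (by omega)))))
  exact this.mono le_rfl hD

lemma mapAll_ops {α β : Type*} (f : α → Counted β) (l : List α) {N D : ℕ}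
    (h : ∀ a ∈ l, OpsBound (f a).ops N D) : OpsBound (mapAll f l).ops (l.length * N) D := by
  induction l with
  | nil => exact .nil
  | cons a l ih =>
    have := (h a (by simp)).append (ih fun b hb => h b (by simp [hb]))
    exact this.mono (by rw [List.length_cons, add_mul, one_mul, add_comm]) le_rfl

lemma dot_ops (ps cs : List (RatFun K)) (acc : RatFun K) {M M' : ℕ} (hS : S ≠ 0)
    (hd : S.totalDegree ≤ d) (hp : ∀ p ∈ ps, PowerFraction S d M p)
    (hc : ∀ c ∈ cs, PowerFraction S d M' c) (hacc : PowerFraction S d (M + M') acc) :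
    OpsBound (dot ps cs acc).ops (ps.length * 2) ((M + M') * d) := by
  induction ps generalizing cs acc with
  | nil => cases cs <;> exact .nil
  | cons p ps ih =>
    obtain _ | ⟨c, cs⟩ := cs
    · exact .nil
    · have h1 := hp p (by simp)
      have h2 := hc c (by simp)
      have h3 := h1.mul h2
      have := ih cs (acc + p * c) (fun q hq => hp q (by simp [hq]))
        (fun q hq => hc q (by simp [hq])) (hacc.add h3)
      have h4 : OpsBound (dot (p :: ps) (c :: cs) acc).ops (1 + (1 + ps.length * 2))
          ((M + M') * d) :=
        .bind (.binary (h1.deg_le_of_le hS hd (by omega)) (h2.deg_le_of_le hS hd (by omega)))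
          (.bind (.binary (hacc.deg_le hS hd) (h3.deg_le hS hd)) this)
      exact h4.mono (by rw [List.length_cons]; omega) le_rfl

lemma HasDenominator.powersDh_ops {inp : ReduceInput K} (h : HasDenominator S d inp) (n m : ℕ) :
    OpsBound (powersDh (partialD 1 inp.R / ((inp.k : RatFun K) * inp.R)) n m
      (_root_.iterDh (partialD 1 inp.R / ((inp.k : RatFun K) * inp.R)) inp.G m)).ops
      (n * 4) ((3 * (m + n) + 4) * d) := by
  induction n generalizing m with
  | zero => exact .nil
  | succ n ih =>
    have hS := h.ne_zero
    have hd := h.degree_le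
    have hv := h.log (h.R.partialD hS hd 1)
    have hg := h.iterDh m
    have hg' := hg.partialD hS hd 1
    have hb := (PowerFraction.natCast (S := S) (d := d) m).mul hv
    have hstep : OpsBound (stepDh (partialD 1 inp.R / ((inp.k : RatFun K) * inp.R)) m
        (_root_.iterDh (partialD 1 inp.R / ((inp.k : RatFun K) * inp.R)) inp.G m)).ops
        (1 + (1 + (1 + 1))) ((3 * (m + (n + 1)) + 4) * d) :=
      .bind (.unary (hg.deg_le_of_le hS hd (by omega)))
        (.bind (.binary ((PowerFraction.natCast m).deg_le_of_le hS hd (by omega))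
          (hv.deg_le_of_le hS hd (by omega)))
        (.bind (.binary (hb.deg_le_of_le hS hd (by omega)) (hg.deg_le_of_le hS hd (by omega)))
        (.binary (hg'.deg_le_of_le hS hd (by omega))
          ((hb.mul hg).deg_le_of_le hS hd (by omega)))))
    have hrest := (ih (m + 1)).mono le_rfl
      (Nat.mul_le_mul_right d (show 3 * (m + 1 + n) + 4 ≤ 3 * (m + (n + 1)) + 4 by omega))
    exact (OpsBound.bind hstep (OpsBound.bind hrest (.nil (n := 0)))).mono (by omega) le_rfl

lemma HasDenominator.integrandTerms_ops {inp : ReduceInput K} (h : HasDenominator S d inp)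
    (e : ℕ) (gs : List (RatFun K)) (n j : ℕ) {M D : ℕ}
    (hg : ∀ i < n, PowerFraction S d M (gs.getD (inp.k * (j + i) + e) 0))
    (hD : (M + j + n) * d ≤ D) :
    OpsBound (integrandTerms inp.R inp.k e gs n j (inp.R ^ j)⁻¹).ops (n * 2) D := by
  have hS := h.ne_zero
  have hd := h.degree_le
  induction n generalizing j with
  | zero => exact .nil
  | succ n ih =>
    have hw : PowerFraction S d j (inp.R ^ j)⁻¹ := by rw [← inv_pow]; exact h.R_inv.pow j
    have h2 : (inp.R ^ j)⁻¹ / inp.R = (inp.R ^ (j + 1))⁻¹ := by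
      rw [pow_succ, mul_inv, div_eq_mul_inv]
    have hrest : OpsBound (integrandTerms inp.R inp.k e gs n (j + 1) ((inp.R ^ j)⁻¹ / inp.R)).ops
        (n * 2) D := by
      rw [h2]
      refine ih (j + 1) (fun i hi => ?_) ((Nat.mul_le_mul_right d (by omega)).trans hD)
      have := hg (i + 1) (by omega)
      rwa [show j + (i + 1) = j + 1 + i by omega] at this
    have hg0 := hg 0 (by omega)
    have hle : ∀ {f : RatFun K} {M' : ℕ}, PowerFraction S d M' f → M' ≤ M + j + (n + 1) →
        f.deg ≤ D := fun hf hM => (hf.deg_le_of_le hS hd hM).trans hD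
    have key : OpsBound (integrandTerms inp.R inp.k e gs (n + 1) j (inp.R ^ j)⁻¹).ops
        (1 + (1 + (n * 2 + 0))) D :=
      .bind (.binary (hle hw (by omega)) (hle hg0 (by omega)))
        (.bind (.binary (hle hw (by omega)) (hle h.R (by omega))) (.bind hrest .nil))
    exact key.mono (by omega) le_rfl

lemma HasDenominator.prepare_ops {inp : ReduceInput K} (h : HasDenominator S d inp) :
    OpsBound (prepare inp).ops (6 * inp.l + 10) ((4 * inp.l + 5) * d) := by
  have hS := h.ne_zero
  have hd := h.degree_le
  have hkR := (PowerFraction.natCast (S := S) (d := d) inp.k).mul h.R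
  have hRy := h.R.partialD hS hd 1
  have hDR := powerFraction_totalDx hS hd h.F h.R
  have hdiv := Nat.div_le_self inp.l inp.k
  have hterms := h.integrandTerms_ops (inp.l % inp.k)
    (powersDh (partialD 1 inp.R / ((inp.k : RatFun K) * inp.R)) inp.l 0 inp.G).val
    (inp.l / inp.k + 1) 0 (M := 3 * inp.l + 1) (D := (4 * inp.l + 5) * d) (fun i hi => by
      have h1 := order_le inp (inp.l / inp.k - i)
      rw [Nat.sub_sub_self (by omega)] at h1
      have h2 := powersDh_getD (partialD 1 inp.R / ((inp.k : RatFun K) * inp.R)) inp.G inp.l 0 _ h1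
      simp only [zero_add] at h2 ⊢
      have h3 : inp.G = _root_.iterDh (partialD 1 inp.R / ((inp.k : RatFun K) * inp.R)) inp.G 0 :=
        rfl
      rw [h3, h2]
      exact (h.iterDh _).mono hS hd (by omega)) (Nat.mul_le_mul_right d (by omega))
  rw [pow_zero, inv_one] at hterms
  have hpow := (h.powersDh_ops inp.l 0).mono le_rfl
    (Nat.mul_le_mul_right d (show 3 * (0 + inp.l) + 4 ≤ 4 * inp.l + 5 by omega))
  have key : OpsBound (prepare inp).ops
      (1 + (1 + (1 + (4 + (1 + (inp.l * 4 + ((inp.l / inp.k + 1) * 2 + 0)))))))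
      ((4 * inp.l + 5) * d) :=
    .bind (.binary ((PowerFraction.natCast inp.k).deg_le_of_le hS hd (by omega))
      (h.R.deg_le_of_le hS hd (by omega)))
    (.bind (.unary (h.R.deg_le_of_le hS hd (by omega)))
    (.bind (.binary (hRy.deg_le_of_le hS hd (by omega)) (hkR.deg_le_of_le hS hd (by omega)))
    (.bind (applyDx_ops hS hd h.F h.R (Nat.mul_le_mul_right d (by omega)))
    (.bind (.binary (hDR.deg_le_of_le hS hd (by omega)) (hkR.deg_le_of_le hS hd (by omega)))
    (.bind hpow (.bind hterms .nil))))))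
  exact key.mono (by omega) le_rfl

lemma HasDenominator.nextRow_ops {inp : ReduceInput K} (h : HasDenominator S d inp) {i : ℕ}
    (hi : i ≤ inp.l + 2) :
    OpsBound (nextRow inp (prepare inp).val.1 (prepare inp).val.2 (rows inp i)).ops
      (6 * (inp.l / inp.k) + 14) ((8 * inp.l + 14) * d) := by
  have hS := h.ne_zero
  have hd := h.degree_le
  obtain ⟨h1, h2⟩ := h.rowSeq i
  have hlen := rows_length inp i
  have hco : ∀ q ∈ (rows inp i).coeffs, PowerFraction S d (2 * i + 1) q := by
    intro q hq
    obtain ⟨c, hc, rfl⟩ := List.getElem_of_mem hq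
    have := h1 c (by omega)
    rwa [ReduceTelescoper.rowSeq, rowVec_toList_of_lt _ hc, List.getD_eq_getElem _ _ hc] at this
  have hrhs : PowerFraction S d (4 * inp.l + 4 * i + 2) (rows inp i).rhs := by
    rw [← hlen, ReduceTelescoper.rowSeq, rowVec_toList_length] at h2
    exact h2
  have hts : ∀ t ∈ (prepare inp).val.2, PowerFraction S d (4 * inp.l + 1) t := by
    intro t ht
    obtain ⟨c, hc, rfl⟩ := List.getElem_of_mem ht
    rw [← List.getD_eq_getElem _ 0, prepare_snd_getD inp (by rwa [← prepare_snd_length])]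
    exact h.integrandTerm c
  have hu : PowerFraction S d 4 (prepare inp).val.1 :=
    h.log (powerFraction_totalDx hS hd h.F h.R)
  have hb := (PowerFraction.natCast (S := S) (d := d) (inp.l % inp.k)).mul hrhs
  have hb' := hb.mul hu
  have ha := powerFraction_totalDx hS hd h.F hrhs
  have hc : PowerFraction S d (2 * i + 1 + (4 * inp.l + 1))
      (dot (rows inp i).coeffs (prepare inp).val.2 0).val := by
    rw [dot_val _ _ _ (by rw [hlen, prepare_snd_length]), zero_add]
    refine PowerFraction.sum fun j hj => ?_
    have hj' := Finset.mem_range.1 hj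
    rw [List.getD_eq_getElem _ _ hj', List.getD_eq_getElem _ _ (by
      rw [prepare_snd_length, ← hlen]; exact hj')]
    exact (hco _ (List.getElem_mem _)).mul (hts _ (List.getElem_mem _))
  have key : OpsBound (nextRow inp (prepare inp).val.1 (prepare inp).val.2 (rows inp i)).ops
      ((rows inp i).coeffs.length * 4 + (4 + (1 + (1 + ((rows inp i).coeffs.length * 2
        + (1 + (1 + 0))))))) ((8 * inp.l + 14) * d) :=
    .bind (mapAll_ops _ _ fun q hq => applyDx_ops hS hd h.F (hco q hq)
      (Nat.mul_le_mul_right d (by omega)))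
    (.bind (applyDx_ops hS hd h.F hrhs (Nat.mul_le_mul_right d (by omega)))
    (.bind (.binary ((PowerFraction.natCast _).deg_le_of_le hS hd (by omega))
      (hrhs.deg_le_of_le hS hd (by omega)))
    (.bind (.binary (hb.deg_le_of_le hS hd (by omega)) (hu.deg_le_of_le hS hd (by omega)))
    (.bind ((dot_ops _ _ _ hS hd hco hts PowerFraction.zero).mono le_rfl
      (Nat.mul_le_mul_right d (by omega)))
    (.bind (.binary (ha.deg_le_of_le hS hd (by omega)) (hb'.deg_le_of_le hS hd (by omega)))
    (.bind (.binary
      (((ha.mono hS hd (by omega)).sub (hb'.mono hS hd le_rfl)).deg_le_of_le hS hd (by omega))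
      (hc.deg_le_of_le hS hd (by omega))) .nil))))))
  exact key.mono (by rw [hlen]; omega) le_rfl

/-- The multiplier is a quotient of two entries, hence degree `2E`; its product with a third entry
reaches `3E`. -/
lemma subMul_ops (f : RatFun K) (as bs : List (RatFun K)) {E : ℕ} (hf : f.deg ≤ 2 * E)
    (ha : ∀ c, (as.getD c 0).deg ≤ E) (hb : ∀ c, (bs.getD c 0).deg ≤ E) :
    OpsBound (subMul f as bs).ops (as.length * 2) (3 * E) := by
  induction as generalizing bs with
  | nil => exact .nil
  | cons a as ih =>
    obtain _ | ⟨b, bs⟩ := bs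
    · exact .nil
    · have ha0 : a.deg ≤ E := ha 0
      have hb0 : b.deg ≤ E := hb 0
      have hm := deg_mul_le f b
      have key : OpsBound (subMul f (a :: as) (b :: bs)).ops (1 + (1 + (as.length * 2 + 0)))
          (3 * E) :=
        .bind (.binary (by omega) (by omega)) (.bind (.binary (by omega) (hm.trans (by omega)))
          (.bind (ih bs (fun c => ha (c + 1)) fun c => hb (c + 1)) .nil))
      exact key.mono (by rw [List.length_cons]; omega) le_rfl

/-- The degree bound is required for every intermediate state rather than propagated from step to
step, which would make degrees grow exponentially. It is supplied by Cramer's rule on prefixes of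
the basis. -/
lemma eliminate_ops {n E : ℕ} {L : ℕ → ℕ → RatFun K} {x : ℕ → RatFun K}
    {B B' : List (ℕ × List (RatFun K))} {row : List (RatFun K)} (hB : Echelon n L (B ++ B'))
    (hrow : ∀ B₁ B₂, B₁ ++ B₂ = B ++ B' → ∀ row', Reduced n L x B₁ row' →
      ∀ c, (row'.getD c 0).deg ≤ E)
    (hb : ∀ b ∈ B', ∀ c, (b.2.getD c 0).deg ≤ E) (h : Reduced n L x B row) :
    OpsBound (eliminate B' row).ops (B'.length * (2 * n + 1)) (3 * E) := by
  induction B' generalizing B row with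
  | nil => exact .nil
  | cons b B' ih =>
    have hr := hrow B (b :: B') rfl row h
    have hb0 := hb b (by simp)
    have hq : (row.getD b.1 0 / b.2.getD b.1 0).deg ≤ 2 * E := by
      have h1 := deg_div_le (row.getD b.1 0) (b.2.getD b.1 0)
      have h2 := hr b.1
      have h3 := hb0 b.1
      omega
    have h4 := ih (B := B ++ [b]) (by simpa using hB)
      (fun B₁ B₂ h12 => hrow B₁ B₂ (by simpa using h12)) (fun b' hb' => hb b' (by simp [hb']))
      (h.step hB)
    have h5 := subMul_ops _ _ _ hq hr hb0
    rw [h.length] at h5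
    have key : OpsBound (eliminate (b :: B') row).ops (1 + (n * 2 + B'.length * (2 * n + 1)))
        (3 * E) :=
      .bind (.binary ((hr _).trans (by omega)) ((hb0 _).trans (by omega))) (.bind h5 h4)
    exact key.mono (by rw [List.length_cons, add_mul]; omega) le_rfl

lemma pivot_ops (j : ℕ) (row : List (RatFun K)) {E : ℕ} (h : ∀ c, (row.getD c 0).deg ≤ E) :
    OpsBound (pivot j row).ops row.length E := by
  induction row generalizing j with
  | nil => exact .nil
  | cons a as ih =>
    refine (OpsBound.bind (n := 1) (n' := as.length) (.unary (h 0)) ?_).mono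
      (by rw [List.length_cons]; omega) le_rfl
    split_ifs
    · exact ih (j + 1) fun c => h (c + 1)
    · exact .nil

/-- A bound for the degrees of the entries in the elimination. -/
def entryBound (inp : ReduceInput K) (d : ℕ) : ℕ :=
  2 * ((inp.l / inp.k + 3) * (8 * inp.l + 10) * d)

/-- A bound for the number of operations in one pass of the loop. -/
def passBound (inp : ReduceInput K) : ℕ :=
  (inp.l / inp.k + 2) * (2 * (inp.l / inp.k + 2) + 1) + (inp.l / inp.k + 2)
    + (6 * (inp.l / inp.k) + 14)

lemma HasDenominator.loopStep_ops {inp : ReduceInput K} (h : HasDenominator S d inp)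
    {st : LoopState K} (hst : LoopInv inp st) :
    OpsBound (loopStep inp (prepare inp).val.1 (prepare inp).val.2 st).ops (passBound inp)
      (3 * entryBound inp d) := by
  have hS := h.ne_zero
  have hd := h.degree_le
  have hlen := hst.echelon.length_le
  have hdiv := Nat.div_le_self inp.l inp.k
  have hE : ∀ t ≤ inp.l / inp.k + 2, 2 * ((t + 1) * (8 * inp.l + 10) * d) ≤ entryBound inp d :=
    fun t ht => Nat.mul_le_mul_left _ (Nat.mul_le_mul_right _ (Nat.mul_le_mul_right _ (by omega)))
  have hrow : ∀ B₁ B₂, B₁ ++ B₂ = st.basis → ∀ row',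
      Reduced (inp.l / inp.k + 2) (ReduceTelescoper.rowSeq inp)
        (ReduceTelescoper.rowSeq inp st.basis.length) B₁ row' →
      ∀ c, (row'.getD c 0).deg ≤ entryBound inp d := by
    intro B₁ B₂ h12 row' hred c
    have hle : B₁.length ≤ st.basis.length := by rw [← h12, List.length_append]; omega
    have hB₁ : Echelon (inp.l / inp.k + 2) (ReduceTelescoper.rowSeq inp) B₁ :=
      Echelon.of_append (B' := B₂) (h12 ▸ hst.echelon)
    exact (hB₁.deg_le_of_reduced hS hd (fun i hi => h.rowSeq_of_le (by omega))
      (h.rowSeq_of_le (by omega)) hred.sub_mem hred.zero c).trans (hE _ (by omega))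
  have hb : ∀ b ∈ st.basis, ∀ c, (b.2.getD c 0).deg ≤ entryBound inp d := fun b hb c =>
    (hst.echelon.deg_le hS hd (fun i hi => h.rowSeq_of_le (by omega)) hb c).trans
      ((Nat.mul_le_mul_left _ (Nat.mul_le_mul_right _ (Nat.mul_le_mul_right _
        (Nat.le_succ _)))).trans (hE _ hlen))
  have hinit : Reduced (inp.l / inp.k + 2) (ReduceTelescoper.rowSeq inp)
      (ReduceTelescoper.rowSeq inp st.basis.length) []
      (st.current.coeffs ++ [st.current.rhs]) := by
    refine ⟨?_, ?_, by simp⟩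
    · rw [hst.current]; exact rows_toList_length inp _
    · rw [hst.current, ReduceTelescoper.rowSeq, RelRow.toList, sub_self]; exact zero_mem _
  have helim := (eliminate_ops (B := []) hst.echelon hrow hb hinit).mono
    (Nat.mul_le_mul_right _ hlen) le_rfl
  have hpiv := (pivot_ops 0 _ (hrow st.basis [] (by simp) _ hst.reduced)).mono
    hst.reduced.length.le (show entryBound inp d ≤ 3 * entryBound inp d by omega)
  have hnext := (h.nextRow_ops (i := st.basis.length) (by omega)).mono le_rfl
    (show (8 * inp.l + 14) * d ≤ 3 * entryBound inp d by
      refine le_trans ?_ (Nat.mul_le_mul_left 3 (hE 0 (by omega)))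
      rw [← mul_assoc, ← mul_assoc]
      exact Nat.mul_le_mul_right _ (by omega))
  rw [← hst.current] at hnext
  rw [loopStep]
  dsimp only
  split
  · exact (helim.append hpiv).mono (by rw [passBound]; omega) le_rfl
  · exact (helim.append hpiv).append hnext

/-- At most `m + 2` passes add a row, and one more detects the dependence: hence `m + 3`, where `m =
⌊l/k⌋`. -/
lemma HasDenominator.loopRuns_ops {inp : ReduceInput K} (h : HasDenominator S d inp)
    {st : LoopState K} {B : List (ℕ × List (RatFun K))} {ops : List ℕ}
    (hr : LoopRuns inp (prepare inp).val.1 (prepare inp).val.2 st B ops) (hst : LoopInv inp st) :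
    OpsBound ops ((inp.l / inp.k + 3 - st.basis.length) * passBound inp)
      (3 * entryBound inp d) := by
  induction hr with
  | halt st B h1 =>
    have hlen := hst.echelon.length_le
    refine (h.loopStep_ops hst).mono ?_ le_rfl
    exact Nat.le_mul_of_pos_left _ (by omega)
  | next st st' B ops h1 _ ih =>
    rcases hst.loopStep with ⟨h2, -⟩ | ⟨st'', h2, h3, h4⟩
    · exact absurd (h2.symm.trans h1) (by simp)
    · obtain rfl : st'' = st' := Sum.inr.inj (h2.symm.trans h1)
      have hlen := h3.echelon.length_le
      refine ((h.loopStep_ops hst).append (ih h3)).mono ?_ le_rfl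
      obtain ⟨j, hj⟩ : ∃ j, inp.l / inp.k + 3 - st.basis.length = j + 1 :=
        ⟨inp.l / inp.k + 2 - st.basis.length, by omega⟩
      rw [hj, show inp.l / inp.k + 3 - st''.basis.length = j by omega, add_mul, one_mul, add_comm]

lemma HasDenominator.normalizeLast_ops {inp : ReduceInput K} (h : HasDenominator S d inp)
    {B : List (ℕ × List (RatFun K))}
    (hB : Echelon (inp.l / inp.k + 2) (ReduceTelescoper.rowSeq inp) B) :
    OpsBound (normalizeLast inp B).ops (inp.l / inp.k + 2) (3 * entryBound inp d) := by
  have hlen := hB.length_le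
  have hdiv := Nat.div_le_self inp.l inp.k
  rw [normalizeLast]
  rcases hmax : B.argmax Prod.fst with _ | ⟨p, b⟩
  · exact .nil
  · dsimp only
    have hbB : (p, b) ∈ B := List.argmax_mem hmax
    have hb : ∀ c, (b.getD c 0).deg ≤ 3 * entryBound inp d := fun c => by
      refine (hB.deg_le h.ne_zero h.degree_le (fun i hi => h.rowSeq_of_le (by omega)) hbB c).trans
        (le_trans ?_ (Nat.le_mul_of_pos_left _ (by omega)))
      exact Nat.mul_le_mul_left _ (Nat.mul_le_mul_right _ (Nat.mul_le_mul_right _ (by omega)))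
    have hblen : b.length = inp.l / inp.k + 2 := (hB.lead _ hbB).2.1
    split_ifs
    · refine (OpsBound.bind (mapAll_ops (N := 1) (D := 3 * entryBound inp d) _ _ fun a ha => ?_)
        (.nil (n := 0))).mono ?_ le_rfl
      · obtain ⟨i, hi, rfl⟩ := List.getElem_of_mem ha
        refine .binary ?_ (hb p)
        have := hb (p + i)
        rw [List.length_drop] at hi
        rwa [List.getD_eq_getElem _ _ (by omega), ← List.getElem_drop] at this
      · rw [List.length_drop, hblen]; omega
    · exact .nil

lemma HasDenominator.runs_ops {inp : ReduceInput K} (h : HasDenominator S d inp)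
    {out : Option (RelRow K)} {ops : List ℕ} (hr : Runs inp out ops) :
    OpsBound ops (6 * inp.l + 10 + (inp.l / inp.k + 3) * passBound inp + (inp.l / inp.k + 2))
      (3 * entryBound inp d) := by
  obtain ⟨B, loopOps, hloop, -, rfl⟩ := hr
  refine ((h.prepare_ops.mono le_rfl ?_).append (h.loopRuns_ops hloop (LoopInv.initial inp))).append
    (h.normalizeLast_ops (hloop.echelon (LoopInv.initial inp)).1)
  rw [entryBound, ← mul_assoc, ← mul_assoc]
  refine Nat.mul_le_mul_right _ ?_
  nlinarith [Nat.zero_le (inp.l / inp.k), Nat.zero_le inp.l]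

end ReduceTelescoper

/-! ### The exponent of matrix multiplication. -/

/-- An exponent of matrix multiplication is at least `2`. -/
lemma IsMatMulExponent.two_le {K : Type*} [Field K] {ω : ℝ} (h : IsMatMulExponent K ω) :
    2 ≤ ω := by
  obtain ⟨A, hA⟩ := h
  have hn : ∀ n : ℕ, 1 ≤ n → (n : ℝ) ^ 2 ≤ A * (n : ℝ) ^ ω := by
    intro n hn
    obtain ⟨r, hr, f, g, W, hmul⟩ := hA n hn
    -- The forms `f t` separate matrices because `X = X · 1` is recovered from the values `f t X`;
    -- therefore `r ≥ n²`.
    have hinj : Function.Injective (LinearMap.pi f) := by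
      rw [← LinearMap.ker_eq_bot, LinearMap.ker_eq_bot']
      intro X hX
      rw [← mul_one X, hmul]
      refine Finset.sum_eq_zero fun t _ => ?_
      rw [show f t X = 0 from congrFun hX t, zero_mul, zero_smul]
    have h1 := LinearMap.finrank_le_finrank_of_injective hinj
    rw [Module.finrank_matrix, Module.finrank_fintype_fun_eq_card] at h1
    simp only [Fintype.card_fin, Module.finrank_self, mul_one] at h1
    have h2 : ((n * n : ℕ) : ℝ) ≤ r := by exact_mod_cast h1
    rw [sq]
    exact (by exact_mod_cast h2 : (n : ℝ) * n ≤ r).trans hr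
  by_contra! hlt
  -- For `ω < 2` the bound `n² ≤ A n^ω` would keep the unbounded sequence `n^(2-ω)` below `A`.
  have htend : Filter.Tendsto (fun n : ℕ => (n : ℝ) ^ (2 - ω)) Filter.atTop Filter.atTop :=
    (tendsto_rpow_atTop (by linarith)).comp tendsto_natCast_atTop_atTop
  obtain ⟨n, hn1, hnA⟩ :=
    ((Filter.eventually_ge_atTop 1).and (htend.eventually_gt_atTop A)).exists
  have hpos : (0 : ℝ) < n := by exact_mod_cast hn1
  have h3 := hn n hn1
  have h4 : (n : ℝ) ^ (2 - ω) * (n : ℝ) ^ ω = (n : ℝ) ^ 2 := by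
    rw [← Real.rpow_add hpos, sub_add_cancel, Real.rpow_two]
  rw [← h4] at h3
  exact absurd (le_of_mul_le_mul_right h3 (Real.rpow_pos_of_pos hpos _)) (not_le.2 hnA)

/-! ### The explicit time bound. -/

namespace ReduceTelescoper

variable {K : Type*} [Field K]

/-- At most `3(l+1)` passes of at most `26(l+1)²` operations each, plus `12(l+1)` for preparation
and normalization: `78 + 12 = 90`. -/
lemma count_le (inp : ReduceInput K) :
    6 * inp.l + 10 + (inp.l / inp.k + 3) * passBound inp + (inp.l / inp.k + 2)
      ≤ 90 * (inp.l + 1) ^ 3 := by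
  have hm := Nat.div_le_self inp.l inp.k
  rw [passBound]
  generalize inp.l / inp.k = m at *
  generalize inp.l = l at *
  have h1 : (m + 2) * (2 * (m + 2) + 1) ≤ (2 * (l + 1)) * (5 * (l + 1)) :=
    Nat.mul_le_mul (by omega) (by omega)
  have h2 : (m + 2) * (2 * (m + 2) + 1) + (m + 2) + (6 * m + 14) ≤ 26 * (l + 1) ^ 2 := by nlinarith
  have h3 := Nat.mul_le_mul (show m + 3 ≤ 3 * (l + 1) by omega) h2
  have h4 : 12 * (l + 1) ≤ 12 * (l + 1) ^ 3 := Nat.mul_le_mul_left _ (Nat.le_self_pow (by omega) _)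
  have h5 : 3 * (l + 1) * (26 * (l + 1) ^ 2) = 78 * (l + 1) ^ 3 := by ring
  omega

lemma three_mul_entryBound_le (inp : ReduceInput K) (N : ℕ) :
    3 * entryBound inp (5 * N) ≤ 900 * N * (inp.l + 1) ^ 2 := by
  have hm := Nat.div_le_self inp.l inp.k
  have h1 := Nat.mul_le_mul (show inp.l / inp.k + 3 ≤ 3 * (inp.l + 1) by omega)
    (show 8 * inp.l + 10 ≤ 10 * (inp.l + 1) by omega)
  have h2 := Nat.mul_le_mul_right (5 * N) h1
  have h3 : 3 * (inp.l + 1) * (10 * (inp.l + 1)) * (5 * N) = 150 * (N * (inp.l + 1) ^ 2) := by ring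
  rw [entryBound, mul_assoc 900]
  omega

/-- With `x = N + l + 3 ≥ 3` the argument is at most `900x³ + 2 ≤ x¹⁰`; dividing by `log 2 ≥ 1/2`
turns `10` into `20`. -/
lemma log_le (N l : ℕ) : (Nat.log 2 (900 * N * (l + 1) ^ 2 + 2) : ℝ)
    ≤ 20 * Real.log ((N + l + 3 : ℕ) : ℝ) := by
  set x : ℝ := ((N + l + 3 : ℕ) : ℝ) with hx
  have hx3 : (3 : ℝ) ≤ x := by
    rw [hx]; push_cast; linarith [N.cast_nonneg (α := ℝ), l.cast_nonneg (α := ℝ)]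
  have hlog1 : 1 ≤ Real.log x := by
    rw [Real.le_log_iff_exp_le (by linarith)]
    exact (Real.exp_one_lt_d9.le.trans (by norm_num)).trans hx3
  have h1 : ((900 * N * (l + 1) ^ 2 + 2 : ℕ) : ℝ) ≤ x ^ 10 := by
    have hN : (N : ℝ) ≤ x := by rw [hx]; push_cast; linarith [l.cast_nonneg (α := ℝ)]
    have hl : (l : ℝ) + 1 ≤ x := by rw [hx]; push_cast; linarith [N.cast_nonneg (α := ℝ)]
    have h3 : (N : ℝ) * ((l : ℝ) + 1) ^ 2 ≤ x * x ^ 2 := by gcongr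
    have h4 : (3 : ℝ) ^ 7 ≤ x ^ 7 := by gcongr
    have h5 : (27 : ℝ) ≤ x ^ 3 := by nlinarith [pow_le_pow_left₀ (by norm_num) hx3 3]
    have h6 : x ^ 10 = x ^ 7 * x ^ 3 := by ring
    push_cast
    nlinarith
  have hlog2 : (1 : ℝ) / 2 ≤ Real.log 2 := by linarith [Real.log_two_gt_d9]
  calc (Nat.log 2 (900 * N * (l + 1) ^ 2 + 2) : ℝ)
      ≤ Real.logb 2 ((900 * N * (l + 1) ^ 2 + 2 : ℕ) : ℝ) := by
        exact_mod_cast Real.natLog_le_logb _ 2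
    _ = Real.log ((900 * N * (l + 1) ^ 2 + 2 : ℕ) : ℝ) / Real.log 2 := rfl
    _ ≤ 10 * Real.log x / (1 / 2) := by
        have h2 := Real.log_le_log (by positivity) h1
        rw [Real.log_pow] at h2
        push_cast at h2 ⊢
        gcongr
    _ = 20 * Real.log x := by ring

lemma runTime_le {inp : ReduceInput K} {N : ℕ} (hR : inp.R ≠ 0) (hN : inp.DegreeLE N)
    {out : Option (RelRow K)} {ops : List ℕ} (hr : Runs inp out ops) (c : ℕ) :
    (runTime c ops : ℝ) ≤ 90 * 901 * 20 ^ c * ((N + 1 : ℕ) : ℝ) * ((inp.l + 1 : ℕ) : ℝ) ^ 5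
      * Real.log ((N + inp.l + 3 : ℕ) : ℝ) ^ c := by
  obtain ⟨S, hS⟩ := exists_hasDenominator hR hN
  have h1 := ((hS.runs_ops hr).mono (count_le inp) (three_mul_entryBound_le inp N)).runTime_le c
  have h2 : 900 * N * (inp.l + 1) ^ 2 + 1 ≤ 901 * ((N + 1) * (inp.l + 1) ^ 2) := by
    have : 1 ≤ (inp.l + 1) ^ 2 := Nat.one_le_pow _ _ (by omega)
    nlinarith
  have h3 : (runTime c ops : ℝ) ≤ ((90 * (inp.l + 1) ^ 3 * ((900 * N * (inp.l + 1) ^ 2 + 1)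
      * Nat.log 2 (900 * N * (inp.l + 1) ^ 2 + 2) ^ c) : ℕ) : ℝ) := by exact_mod_cast h1
  have h4 : ((900 * N * (inp.l + 1) ^ 2 + 1 : ℕ) : ℝ)
      ≤ ((901 * ((N + 1) * (inp.l + 1) ^ 2) : ℕ) : ℝ) := by exact_mod_cast h2
  refine h3.trans ?_
  rw [Nat.cast_mul, Nat.cast_mul _ (Nat.log _ _ ^ c), Nat.cast_pow (Nat.log _ _)]
  calc ((90 * (inp.l + 1) ^ 3 : ℕ) : ℝ) * (((900 * N * (inp.l + 1) ^ 2 + 1 : ℕ) : ℝ)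
        * (Nat.log 2 (900 * N * (inp.l + 1) ^ 2 + 2) : ℝ) ^ c)
      ≤ ((90 * (inp.l + 1) ^ 3 : ℕ) : ℝ) * (((901 * ((N + 1) * (inp.l + 1) ^ 2) : ℕ) : ℝ)
        * (20 * Real.log ((N + inp.l + 3 : ℕ) : ℝ)) ^ c) := by
        gcongr
        exact log_le N inp.l
    _ = _ := by
        rw [mul_pow]
        push_cast
        ring

end ReduceTelescoper

theorem mainTheorem5 (K : Type*) [Field K] [Algebra K ℂ] :
    -- Existence: a nontrivial `k`-pseudo telescoper gives a true telescoper.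
    (∀ (F G R : RatFun ℂ) (k : ℕ) (Ω : Set (ℂ × ℂ)) (Φ : ℂ × ℂ → ℂ) (D : Set (ℂ × ℂ))
        (y I : ℂ × ℂ → ℂ),
      IsDarbouxianIntegral F G R k Ω Φ D y I → NoRationalFirstIntegral F →
      (∃ (l : ℕ) (Q : ℕ → MvPolynomial (Fin 2) ℂ) (P : MvPolynomial (Fin 2) ℂ),
        PseudoNontrivial k l Q P ∧ IsPseudoTelescoper k l Φ D y I Q P) →
      ∃ (s j : ℕ) (a : ℕ → ℂ) (H : RatFun ℂ), IsTelescoper k s j Φ D y I a H) ∧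
    -- The algorithm always terminates.
    (∀ inp : ReduceInput K, inp.R ≠ 0 → 1 ≤ inp.k → ∃ out ops, ReduceTelescoper.Runs inp out ops) ∧
    -- On a nontrivial `k`-pseudo telescoper it returns a true telescoper.
    (∀ (inp : ReduceInput K) (out : Option (RelRow K)) (ops : List ℕ),
      ReduceTelescoper.Runs inp out ops →
      ∀ (Ω : Set (ℂ × ℂ)) (Φ : ℂ × ℂ → ℂ) (D : Set (ℂ × ℂ)) (y I : ℂ × ℂ → ℂ),
        IsDarbouxianIntegral inp.F inp.G inp.R inp.k Ω Φ D y I → NoRationalFirstIntegral inp.F →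
        PseudoNontrivial inp.k inp.l inp.Q inp.P →
        IsPseudoTelescoper inp.k inp.l Φ D y I inp.Q inp.P →
        ∃ (s : ℕ) (a : ℕ → K) (H : RatFun K),
          out = some ⟨((List.range (s + 1)).map fun i => RatFun.const (a i)).reverse, H⟩ ∧
          IsTelescoper inp.k s (inp.l % inp.k) Φ D y I a H) ∧
    -- Running time `Õ(N ord ^ (ω + 3))`.
    (∀ ω : ℝ, IsMatMulExponent K ω → ∀ c : ℕ, ∃ (A : ℝ) (e : ℕ),
      ∀ (inp : ReduceInput K) (N : ℕ), inp.R ≠ 0 → 1 ≤ inp.k → inp.DegreeLE N →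
        ∀ (out : Option (RelRow K)) (ops : List ℕ), ReduceTelescoper.Runs inp out ops →
          (runTime c ops : ℝ) ≤ A * ((N + 1 : ℕ) : ℝ) * ((inp.l + 1 : ℕ) : ℝ) ^ (ω + 3)
            * Real.log ((N + inp.l + 3 : ℕ) : ℝ) ^ e) := by
  refine ⟨?_, fun inp _ _ => ReduceTelescoper.exists_runs inp, ?_, ?_⟩
  · rintro F G R k Ω Φ D y I h hF ⟨l, Q, P, hnt, hpt⟩
    -- Existence is obtained by running the algorithm over `ℂ` on the given pseudo telescoper.
    obtain ⟨out, ops, hruns⟩ := ReduceTelescoper.exists_runs ⟨F, G, R, k, l, Q, P⟩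
    obtain ⟨s, a, H, -, ht⟩ := hruns.telescoper h hF hnt hpt
    exact ⟨s, l % k, a, H, ht⟩
  · intro inp out ops hruns Ω Φ D y I h hF hnt hpt
    exact hruns.telescoper h hF hnt hpt
  · intro ω hω c
    refine ⟨90 * 901 * 20 ^ c, c, fun inp N hR _ hN out ops hruns => ?_⟩
    refine (ReduceTelescoper.runTime_le hR hN hruns c).trans ?_
    have hl : (1 : ℝ) ≤ ((inp.l + 1 : ℕ) : ℝ) := by exact_mod_cast Nat.le_add_left 1 inp.l
    -- Cubically many operations on degrees `O(N(l+1)²)` give exponent `5`, and `5 ≤ ω + 3` since `ω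
    -- ≥ 2`.
    have hpow : ((inp.l + 1 : ℕ) : ℝ) ^ 5 ≤ ((inp.l + 1 : ℕ) : ℝ) ^ (ω + 3) := by
      rw [← Real.rpow_natCast _ 5]
      refine Real.rpow_le_rpow_of_exponent_le hl ?_
      have := hω.two_le
      push_cast
      linarith
    have hlog : 0 ≤ Real.log ((N + inp.l + 3 : ℕ) : ℝ) := Real.log_natCast_nonneg _
    gcongr
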